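/- For positive integers $a,b,c$ put $S(a,b,c)=\{(x,y)\in\mathbb{Z}_{\ge 1}^2 : a^x+b=c^y\}$. Then $$\max_{\substack{2\le a\le 250\\ 1\le b\le 250\\ 2\le c\le 250}} \# S(a,b,c)=2,$$ that is, for all integers $a,b,c$ with $2\le a\le 250$, $1\le b\le 250$, $2\le c\le 250$ the equation $a^x+b=c^y$ has at most two solutions in positive integers $x,y$, and the value two is attained (in particular each $S(a,b,c)$ in this range is finite). Moreover, in this range $\# S(a,b,c)=2$ holds for exactly ten triples $(a,b,c)$, and for these the complete solution sets are: - $2^x+1=3^y$: $\{(1,1),(3,2)\}$; - $2^x+4=6^y$: $\{(1,1),(5,2)\}$; - $2^x+89=91^y$: $\{(1,1),(13,2)\}$; - $3^x+5=2^y$: $\{(1,3),(3,5)\}$; - $3^x+10=13^y$: $\{(1,1),(7,3)\}$; - $3^x+13=2^y$: $\{(1,4),(5,8)\}$; - $3^x+13=4^y$: $\{(1,2),(5,4)\}$; - $3^x+13=16^y$: $\{(1,1),(5,2)\}$; - $5^x+3=2^y$: $\{(1,3),(3,7)\}$; - $6^x+9=15^y$: $\{(1,1),(3,2)\}$. -/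

import Mathlib

/-- The set of pairs `(x, y)` of positive integers with `a ^ x + b = c ^ y`. -/
def solutionSet (a b c : ℕ) : Set (ℕ × ℕ) :=
  {p | 1 ≤ p.1 ∧ 1 ≤ p.2 ∧ a ^ p.1 + b = c ^ p.2}

/-- The range of parameters: `2 ≤ a ≤ 250`, `1 ≤ b ≤ 250`, `2 ≤ c ≤ 250`. -/
def InRange (a b c : ℕ) : Prop :=
  (2 ≤ a ∧ a ≤ 250) ∧ (1 ≤ b ∧ b ≤ 250) ∧ (2 ≤ c ∧ c ≤ 250)

/-- The triples `(a, b, c)` of the ten equations that have two solutions. -/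
def twoSolutionTriples : Finset (ℕ × ℕ × ℕ) :=
  {(2, 1, 3), (2, 4, 6), (2, 89, 91), (3, 5, 2), (3, 10, 13),
   (3, 13, 2), (3, 13, 4), (3, 13, 16), (5, 3, 2), (6, 9, 15)}

/-!
Write `D = |a ^ x - c ^ y| ≤ 250` with `2 ≤ a < c ≤ 250`. The proof determines all pairs
of coincidences `a ^ x₁ - c ^ y₁ = a ^ x₂ - c ^ y₂` of this kind, for either sign of the difference,
in four steps.

*Common powers.* If `a` and `c` are powers of a common `g`, a nonzero difference of two powers of `g`
determines both exponents (`pow_add_pow_ne`). From now on `a` and `c` are multiplicatively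
independent.

*A bound for the exponents.* If `x ≥ 10 ^ 8`, then `x * log a - y * log c` is so small that the method
of interpolation determinants for linear forms in two logarithms applies
(`exponent_lt_of_coprime`; a common factor of `x` and `y` is excluded in `exponent_lt` because distinct
perfect powers with the same exponent are far apart). Consider the functions
`(r * x + s * y) ^ k * (c ^ r * a ^ s) ^ l` with `k < K` and `l < L` at integer points `(r, s)` of a
square. A zero estimate (`eq_zero_of_eval_eq_zero`) provides `K * L` points at which their determinant
is nonzero; being an integer, it is at least `1` in absolute value. On the other hand
`c ^ r * a ^ s` is nearly an exponential function of `w = r * x + s * y`, so the entries are nearly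
values of the functions `w ^ k * exp (l * β * w)` of one variable, and the Taylor expansion of these
shows that the determinant is tiny (`pow_mul_abs_det_exp_le`). All bases being integers, no
further arithmetic enters. The resulting bound is crude but independent of the bases.

*Reduction to small powers.* For `x ≤ 10 ^ 8` the Euclidean algorithm, run on integer approximations
of `2 ^ 100 * log a` and `2 ^ 100 * log c`, bounds `|x * log a - y * log c|` from below by the law of
best approximation (`euclidRem_le_abs`). The bound obtained contradicts `D ≤ 250` as soon as
`a ^ x > 2 ^ 52` (`pow_le_of_close`).

*Enumeration.* For each pair of bases, the coincidences with `a ^ x₂ ≤ 2 ^ 52` are listed by a merging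
walk through the powers of `a` and of `c`. The Euclidean algorithm and the walk for all
pairs are evaluated by the kernel (`checkTable_eq_true`).
-/

/-! ### Upper bounds for interpolation determinants -/

/-- A family of weights in which a weight below `n` occurs at most once, indexed by `n` elements,
has sum at least `0 + 1 + ⋯ + (n - 1)`. -/
lemma sum_range_card_le_sum {ι : Type*} [Fintype ι] (r : ι → ℕ)
    (hr : ∀ i j, r i = r j → r i < Fintype.card ι → i = j) :
    ∑ t ∈ Finset.range (Fintype.card ι), t ≤ ∑ i, r i := by
  classical
  set n := Fintype.card ι with hn
  have h1 : ∀ t < n, n - 1 - t ≤ (Finset.univ.filter fun i => t < r i).card := by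
    intro t ht
    have h2 : (Finset.univ.filter fun i => ¬ t < r i).card ≤ t + 1 := by
      rw [← Finset.card_range (t + 1)]
      refine Finset.card_le_card_of_injOn r ?_ ?_
      · intro i hi
        simp only [Finset.coe_filter, Set.mem_ofPred_eq, Finset.mem_univ, true_and] at hi
        simp only [Finset.coe_range, Set.mem_Iio]
        omega
      · intro i hi j _ hij
        simp only [Finset.coe_filter, Set.mem_ofPred_eq, Finset.mem_univ, true_and] at hi
        exact hr i j hij (by omega)
    have h3 := Finset.card_filter_add_card_filter_not (s := (Finset.univ : Finset ι))
      (p := fun i => t < r i)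
    rw [Finset.card_univ] at h3
    omega
  calc ∑ t ∈ Finset.range n, t = ∑ t ∈ Finset.range n, (n - 1 - t) :=
        (Finset.sum_range_reflect (fun t => t) n).symm
    _ ≤ ∑ t ∈ Finset.range n, (Finset.univ.filter fun i => t < r i).card :=
        Finset.sum_le_sum fun t ht => h1 t (Finset.mem_range.1 ht)
    _ = ∑ i, ((Finset.range n).filter fun t => t < r i).card := by
        simp only [Finset.card_filter]
        exact Finset.sum_comm
    _ ≤ ∑ i, r i := by
        refine Finset.sum_le_sum fun i _ => ?_
        calc _ ≤ (Finset.range (r i)).card := Finset.card_le_card fun t ht => by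
              simpa using (Finset.mem_filter.1 ht).2
          _ = r i := Finset.card_range _

lemma abs_det_le_factorial_mul_prod {ι : Type*} [Fintype ι] [DecidableEq ι]
    (A : Matrix ι ι ℝ) (c : ι → ℝ) (h : ∀ i j, |A i j| ≤ c i) :
    |A.det| ≤ (Fintype.card ι).factorial * ∏ i, c i := by
  rw [Matrix.det_apply']
  refine (Finset.abs_sum_le_sum_abs _ _).trans ?_
  have : ∀ σ ∈ (Finset.univ : Finset (Equiv.Perm ι)),
      |((Equiv.Perm.sign σ : ℤ) : ℝ) * ∏ i, A (σ i) i| ≤ ∏ i, c i := by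
    intro σ _
    rw [abs_mul, Finset.abs_prod]
    have h1 : |((Equiv.Perm.sign σ : ℤ) : ℝ)| = 1 := by
      rcases Int.units_eq_one_or (Equiv.Perm.sign σ) with h | h <;> simp [h]
    rw [h1, one_mul, ← Equiv.prod_comp σ c]
    exact Finset.prod_le_prod (fun i _ => abs_nonneg _) fun i _ => h _ _
  refine (Finset.sum_le_card_nsmul _ _ _ this).trans ?_
  rw [Finset.card_univ, Fintype.card_perm, nsmul_eq_mul]

/-- An algebraic substitute for the Schwarz lemma. Expand the determinant along the rows: a term
that picks the same power `w ^ m` from two rows vanishes, so the powers picked have total exponent at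
least `0 + 1 + ⋯ + (N - 1)`, where the choice of a remainder `d i` counts as exponent `N`. -/
theorem pow_mul_abs_det_le {ι : Type*} [Fintype ι] [DecidableEq ι] (M d : Matrix ι ι ℝ)
    (a : ι → ℕ → ℝ) (w D F : ι → ℝ) (ρ E : ℝ) (hE : 1 ≤ E) (hw : ∀ j, |w j| ≤ ρ)
    (hM : ∀ i j, M i j = ∑ m : Fin (Fintype.card ι), a i m * w j ^ (m : ℕ) + d i j)
    (hd : ∀ i j, |d i j| ≤ D i)
    (hF : ∀ i, ∑ m : Fin (Fintype.card ι), |a i m| * (E * ρ) ^ (m : ℕ)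
      + E ^ Fintype.card ι * D i ≤ F i) :
    E ^ (∑ t ∈ Finset.range (Fintype.card ι), t) * |M.det| ≤
      (Fintype.card ι).factorial * ∏ i, F i := by
  set N := Fintype.card ι with hN
  let coef : ι → Option (Fin N) → ℝ := fun i o => o.elim 1 fun m => a i m
  let base : ι → Option (Fin N) → ι → ℝ := fun i o j => o.elim (d i j) fun m => w j ^ (m : ℕ)
  let wt : Option (Fin N) → ℕ := fun o => o.elim N fun m => m
  let c : ι → Option (Fin N) → ℝ := fun i o => o.elim (D i) fun m => |a i m| * ρ ^ (m : ℕ)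
  have hE0 : 0 ≤ E := by linarith
  have hD : ∀ i, 0 ≤ D i := fun i => (abs_nonneg _).trans (hd i i)
  have hρ : ∀ _ : ι, 0 ≤ ρ := fun j => (abs_nonneg _).trans (hw j)
  have hc : ∀ i o, 0 ≤ c i o := by
    intro i o
    rcases o with _ | m
    · exact hD i
    · exact mul_nonneg (abs_nonneg _) (pow_nonneg (hρ i) _)
  have hrow : M = fun i => ∑ o : Option (Fin N), fun j => coef i o * base i o j := by
    funext i j
    rw [hM, Finset.sum_apply, Fintype.sum_option]
    simp [coef, base, add_comm]
  have hdet : M.det = ∑ r : ι → Option (Fin N),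
      Matrix.det (Matrix.of fun i j => coef i (r i) * base i (r i) j) := by
    conv_lhs => rw [hrow]
    exact (Matrix.detRowAlternating (R := ℝ) (n := ι)).toMultilinearMap.map_sum
      (fun i o => fun j => coef i o * base i o j)
  have hterm : ∀ r : ι → Option (Fin N),
      E ^ (∑ t ∈ Finset.range N, t) *
        |Matrix.det (Matrix.of fun i j => coef i (r i) * base i (r i) j)| ≤
      N.factorial * ∏ i, E ^ wt (r i) * c i (r i) := by
    intro r
    have hpos : 0 ≤ N.factorial * ∏ i, E ^ wt (r i) * c i (r i) :=
      mul_nonneg (by positivity)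
        (Finset.prod_nonneg fun i _ => mul_nonneg (pow_nonneg hE0 _) (hc _ _))
    by_cases hinj : ∀ i j, wt (r i) = wt (r j) → wt (r i) < N → i = j
    · have h1 := sum_range_card_le_sum (fun i => wt (r i)) hinj
      have h2 : |Matrix.det (Matrix.of fun i j => coef i (r i) * base i (r i) j)| ≤
          N.factorial * ∏ i, c i (r i) := by
        refine abs_det_le_factorial_mul_prod _ _ fun i j => ?_
        rw [Matrix.of_apply]
        cases h : r i with
        | none => simpa [coef, base, c] using hd i j
        | some m =>
          simp only [coef, base, c, Option.elim, abs_mul, abs_pow]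
          exact mul_le_mul_of_nonneg_left (pow_le_pow_left₀ (abs_nonneg _) (hw j) _)
            (abs_nonneg _)
      rw [Finset.prod_mul_distrib, Finset.prod_pow_eq_pow_sum]
      calc _ ≤ E ^ (∑ i, wt (r i)) * (N.factorial * ∏ i, c i (r i)) :=
            mul_le_mul (pow_le_pow_right₀ hE h1) h2 (abs_nonneg _) (pow_nonneg hE0 _)
        _ = _ := by ring
    · push Not at hinj
      obtain ⟨i, j, hij, hlt, hne⟩ := hinj
      have h0 : Matrix.det (Matrix.of fun i j => coef i (r i) * base i (r i) j) = 0 := by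
        have h3 := Matrix.det_mul_column (fun i => coef i (r i))
          (Matrix.of fun i j => base i (r i) j)
        simp only [Matrix.of_apply] at h3
        rw [h3, Matrix.det_zero_of_row_eq hne, mul_zero]
        funext t
        simp only [Matrix.of_apply, base]
        cases hi : r i with
        | none => simp [hi, wt] at hlt
        | some m =>
          cases hj : r j with
          | none => simp [hi, hj, wt] at hij hlt; omega
          | some m' => simp [hi, hj, wt] at hij; simp [hij]
      rw [h0, abs_zero, mul_zero]
      exact hpos
  calc E ^ (∑ t ∈ Finset.range N, t) * |M.det|
      ≤ E ^ (∑ t ∈ Finset.range N, t) * ∑ r : ι → Option (Fin N),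
        |Matrix.det (Matrix.of fun i j => coef i (r i) * base i (r i) j)| := by
        rw [hdet]
        exact mul_le_mul_of_nonneg_left (Finset.abs_sum_le_sum_abs _ _) (pow_nonneg hE0 _)
    _ ≤ ∑ r : ι → Option (Fin N), N.factorial * ∏ i, E ^ wt (r i) * c i (r i) := by
        rw [Finset.mul_sum]
        exact Finset.sum_le_sum fun r _ => hterm r
    _ = N.factorial * ∏ i, ∑ o, E ^ wt o * c i o := by
        rw [← Finset.mul_sum, Finset.prod_univ_sum, Fintype.piFinset_univ]
    _ ≤ N.factorial * ∏ i, F i := by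
        refine mul_le_mul_of_nonneg_left (Finset.prod_le_prod (fun i _ => Finset.sum_nonneg
          fun o _ => mul_nonneg (pow_nonneg hE0 _) (hc _ _)) fun i _ => ?_) (by positivity)
        refine le_trans (le_of_eq ?_) (hF i)
        rw [Fintype.sum_option, add_comm]
        simp only [wt, c, Option.elim]
        congr 1
        refine Finset.sum_congr rfl fun m _ => ?_
        rw [mul_pow]
        ring

/-- The part of order at least `N` of a power series with nonnegative coefficients gains a factor
`E ^ N` when the argument is multiplied by `E`. -/
lemma sum_add_pow_mul_tail_le {a : ℕ → ℝ} {f : ℝ → ℝ} (ha : ∀ m, 0 ≤ a m)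
    (hf : ∀ w, 0 ≤ w → HasSum (fun m => a m * w ^ m) (f w)) {E ρ w : ℝ} (hE : 1 ≤ E)
    (hw : 0 ≤ w) (hwρ : w ≤ ρ) (N : ℕ) :
    ∑ m : Fin N, a m * (E * ρ) ^ (m : ℕ) + E ^ N * (f w - ∑ m : Fin N, a m * w ^ (m : ℕ))
      ≤ f (E * ρ) := by
  have hE0 : 0 ≤ E := by linarith
  have hρ : 0 ≤ ρ := hw.trans hwρ
  have h1 := hf w hw
  have h2 := hf (E * ρ) (mul_nonneg hE0 hρ)
  have h1' := (hasSum_nat_add_iff' N).2 h1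
  have h2' := (hasSum_nat_add_iff' N).2 h2
  rw [Finset.sum_range] at h1' h2'
  have h3 := hasSum_le (fun m => ?_) (h1'.mul_left (E ^ N)) h2'
  · linarith
  · rw [mul_left_comm]
    refine mul_le_mul_of_nonneg_left ?_ (ha _)
    calc E ^ N * w ^ (m + N) ≤ E ^ (m + N) * ρ ^ (m + N) :=
          mul_le_mul (pow_le_pow_right₀ hE (by omega)) (pow_le_pow_left₀ hw hwρ _)
            (pow_nonneg hw _) (pow_nonneg hE0 _)
      _ = (E * ρ) ^ (m + N) := (mul_pow _ _ _).symm

/-- The `m`-th Taylor coefficient at `0` of `w ↦ w ^ k * exp (b * w)`. -/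
noncomputable def powMulExpCoeff (k : ℕ) (b : ℝ) (m : ℕ) : ℝ :=
  if k ≤ m then b ^ (m - k) / (m - k).factorial else 0

lemma powMulExpCoeff_nonneg (k : ℕ) {b : ℝ} (hb : 0 ≤ b) (m : ℕ) : 0 ≤ powMulExpCoeff k b m := by
  unfold powMulExpCoeff
  split_ifs
  · positivity
  · exact le_rfl

lemma hasSum_powMulExpCoeff (k : ℕ) (b w : ℝ) :
    HasSum (fun m => powMulExpCoeff k b m * w ^ m) (w ^ k * Real.exp (b * w)) := by
  have h := (NormedSpace.expSeries_div_hasSum_exp (b * w)).mul_left (w ^ k)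
  rw [← Real.exp_eq_exp_ℝ] at h
  rw [← (add_left_injective k).hasSum_iff]
  · refine h.congr_fun fun m => ?_
    simp [powMulExpCoeff, pow_add, mul_pow]
    ring
  · intro m hm
    have : ¬ k ≤ m := fun hk => hm ⟨m - k, by simp [hk]⟩
    simp [powMulExpCoeff, this]

/-- A determinant whose entries are values of the functions `w ^ k * exp (b * w)` at points of
`[0, ρ]`, up to a tiny relative error, is small. -/
theorem pow_mul_abs_det_exp_le {ι : Type*} [Fintype ι] [DecidableEq ι] (M : Matrix ι ι ℝ)
    (k : ι → ℕ) (b w : ι → ℝ) (ρ E ε : ℝ) (hE : 1 ≤ E) (hb : ∀ i, 0 ≤ b i)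
    (hw : ∀ j, 0 ≤ w j) (hwρ : ∀ j, w j ≤ ρ) (hε : E ^ Fintype.card ι * ε ≤ 1)
    (hε0 : 0 ≤ ε)
    (hM : ∀ i j, |M i j - w j ^ k i * Real.exp (b i * w j)| ≤
      ε * (w j ^ k i * Real.exp (b i * w j))) :
    E ^ (∑ t ∈ Finset.range (Fintype.card ι), t) * |M.det| ≤
      (Fintype.card ι).factorial *
        ∏ i, (2 * ((E * ρ) ^ k i * Real.exp (b i * (E * ρ)))) := by
  set N := Fintype.card ι with hN
  have hE0 : 0 < E := by linarith
  let f : ι → ℝ → ℝ := fun i z => z ^ k i * Real.exp (b i * z)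
  let a : ι → ℕ → ℝ := fun i m => powMulExpCoeff (k i) (b i) m
  have key := fun i j => sum_add_pow_mul_tail_le (f := f i)
    (powMulExpCoeff_nonneg (k i) (hb i)) (fun z _ => hasSum_powMulExpCoeff (k i) (b i) z) hE
    (hw j) (hwρ j) N
  have hmono : ∀ i z, 0 ≤ z → z ≤ E * ρ → f i z ≤ f i (E * ρ) := by
    intro i z hz hzρ
    exact mul_le_mul (pow_le_pow_left₀ hz hzρ _)
      (Real.exp_le_exp.2 (mul_le_mul_of_nonneg_left hzρ (hb i))) (Real.exp_pos _).le
      (pow_nonneg (hz.trans hzρ) _)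
  have hwE : ∀ j, w j ≤ E * ρ := fun j =>
    (hwρ j).trans (le_mul_of_one_le_left ((hw j).trans (hwρ j)) hE)
  refine pow_mul_abs_det_le M (fun i j => M i j - ∑ m : Fin N, a i m * w j ^ (m : ℕ)) a w
    (fun i => (f i (E * ρ) - ∑ m : Fin N, a i m * (E * ρ) ^ (m : ℕ)) / E ^ N
      + ε * f i (E * ρ)) _ ρ E hE
    (fun j => by rw [abs_of_nonneg (hw j)]; exact hwρ j) (fun i j => by ring) (fun i j => ?_)
    (fun i => ?_)
  · have h0 : 0 ≤ f i (w j) - ∑ m : Fin N, a i m * w j ^ (m : ℕ) := by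
      rw [sub_nonneg, Fin.sum_univ_eq_sum_range (fun m => a i m * w j ^ m)]
      exact sum_le_hasSum _ (fun m _ => mul_nonneg (powMulExpCoeff_nonneg _ (hb i) _)
        (pow_nonneg (hw j) _)) (hasSum_powMulExpCoeff (k i) (b i) (w j))
    have h1 : f i (w j) - ∑ m : Fin N, a i m * w j ^ (m : ℕ) ≤
        (f i (E * ρ) - ∑ m : Fin N, a i m * (E * ρ) ^ (m : ℕ)) / E ^ N := by
      rw [le_div_iff₀ (by positivity)]
      have := key i j
      simp only [a] at *
      linarith
    have h2 : |M i j - f i (w j)| ≤ ε * f i (E * ρ) :=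
      (hM i j).trans (mul_le_mul_of_nonneg_left (hmono i _ (hw j) (hwE j)) hε0)
    calc |M i j - ∑ m : Fin N, a i m * w j ^ (m : ℕ)|
        = |(f i (w j) - ∑ m : Fin N, a i m * w j ^ (m : ℕ)) + (M i j - f i (w j))| := by
          congr 1; ring
      _ ≤ _ := (abs_add_le _ _).trans (add_le_add ((abs_of_nonneg h0).le.trans h1) h2)
  · have hfpos : 0 ≤ f i (E * ρ) :=
      mul_nonneg (pow_nonneg ((hw i).trans (hwE i)) _) (Real.exp_pos _).le
    have h1 : ∀ m : Fin N, |a i m| = a i m := fun m =>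
      abs_of_nonneg (powMulExpCoeff_nonneg _ (hb i) _)
    simp only [h1]
    rw [mul_add, mul_div_cancel₀ _ (by positivity), ← mul_assoc]
    have h2 := mul_le_mul_of_nonneg_right hε hfpos
    simp only [f] at *
    linarith

/-! ### A zero estimate -/

/-- Vectors on which no nonzero linear functional vanishes contain a basis. -/
lemma exists_det_ne_zero {ι J : Type*} [Fintype ι] [DecidableEq ι] (f : J → ι → ℝ)
    (h : ∀ v : ι → ℝ, (∀ j, ∑ i, v i * f j i = 0) → v = 0) :
    ∃ g : ι → J, (Matrix.of fun i j => f (g j) i).det ≠ 0 := by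
  have hspan : Submodule.span ℝ (Set.range f) = ⊤ := by
    by_contra hne
    obtain ⟨φ, hφ, hle⟩ := Submodule.exists_le_ker_of_lt_top _ (lt_top_iff_ne_top.2 hne)
    apply hφ
    have hφv : ∀ u : ι → ℝ, φ u = ∑ i, φ (Pi.single i 1) * u i := by
      intro u
      conv_lhs => rw [pi_eq_sum_univ' u]
      simp [map_sum, mul_comm]
    have := h (fun i => φ (Pi.single i 1)) fun j => by
      rw [← hφv]
      exact hle (Submodule.subset_span ⟨j, rfl⟩)
    refine LinearMap.ext fun u => ?_
    rw [hφv]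
    simp [funext_iff] at this
    simp [this]
  obtain ⟨κ, a, -, hsp, hli⟩ := exists_linearIndependent' ℝ f
  rw [hspan] at hsp
  let B := Module.Basis.mk hli hsp.ge
  let e : ι ≃ κ := (Pi.basisFun ℝ ι).indexEquiv B
  refine ⟨a ∘ e, ?_⟩
  have hli' : LinearIndependent ℝ (fun j => f (a (e j))) := hli.comp e e.injective
  rw [← Matrix.det_transpose]
  have : (Matrix.of fun i j => f ((a ∘ e) j) i).transpose = Matrix.of fun j => f (a (e j)) := by
    ext; rfl
  rw [this, ← isUnit_iff_ne_zero, ← Matrix.isUnit_iff_isUnit_det,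
    ← Matrix.linearIndependent_rows_iff_isUnit]
  exact hli'

open Polynomial in
lemma coeff_prod_sum_of_natDegree_le {ι : Type*} (s : Finset ι) (f : ι → ℝ[X]) (d : ι → ℕ)
    (h : ∀ i ∈ s, (f i).natDegree ≤ d i) :
    (∏ i ∈ s, f i).coeff (∑ i ∈ s, d i) = ∏ i ∈ s, (f i).coeff (d i) := by
  classical
  induction s using Finset.induction_on with
  | empty => simp
  | insert a s ha ih =>
    have hs : ∀ i ∈ s, (f i).natDegree ≤ d i := fun i hi => h i (Finset.mem_insert_of_mem hi)
    rw [Finset.prod_insert ha, Finset.sum_insert ha, Finset.prod_insert ha, ← ih hs]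
    exact coeff_mul_add_eq_of_natDegree_le (h a (Finset.mem_insert_self _ _))
      ((natDegree_prod_le _ _).trans (Finset.sum_le_sum hs))

open Polynomial in
/-- A polynomial `∑ l, P l * Y ^ l` in two variables, of degree less than `L` in `Y` and less than
`K` in the first variable, that vanishes at all points `(X (g + h), Y (g + h))` for `g ∈ A` and
`h ∈ B` is zero, provided `Y` takes at least `L` values on `A` and `X` takes more than
`(K - 1) * L` values on `B`. The reason: the nonzero `P l`, translated by the `X g` and scaled
by the `Y g`, form a square polynomial matrix that is singular at all `X h`, while the leading
coefficient of its determinant is a minor of a Vandermonde matrix. -/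
theorem eq_zero_of_eval_eq_zero {G : Type*} [Add G] {K L : ℕ} (P : Fin L → ℝ[X])
    (hP : ∀ l, (P l).natDegree ≤ K - 1) (X Y : G → ℝ) (hX : ∀ g h, X (g + h) = X g + X h)
    (hY : ∀ g h, Y (g + h) = Y g * Y h) (hY0 : ∀ g, Y g ≠ 0) (A B : Finset G)
    (hA : L ≤ A.card) (hAY : Set.InjOn Y A) (hB : (K - 1) * L < B.card) (hBX : Set.InjOn X B)
    (h0 : ∀ g ∈ A, ∀ h ∈ B, ∑ l, (P l).eval (X (g + h)) * Y (g + h) ^ (l : ℕ) = 0) :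
    ∀ l, P l = 0 := by
  classical
  by_contra! hne
  obtain ⟨l₀, hl₀⟩ := hne
  let S := {l : Fin L // P l ≠ 0}
  -- A polynomial of degree less than `L` vanishing at the `Y g` is zero, so some minor of the
  -- Vandermonde matrix with columns in `S` does not vanish.
  obtain ⟨γ, hγ⟩ := exists_det_ne_zero (ι := S) (J := A) (fun g l => Y g ^ (l.1 : ℕ)) (by
    intro v hv
    let p : ℝ[X] := ∑ l : S, C (v l) * Polynomial.X ^ (l.1 : ℕ)
    have hp : p = 0 := by
      refine Polynomial.eq_zero_of_natDegree_lt_card_of_eval_eq_zero' p (A.image Y) ?_ ?_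
      · intro y hy
        obtain ⟨g, hg, rfl⟩ := Finset.mem_image.1 hy
        simpa [p, eval_finsetSum] using hv ⟨g, hg⟩
      · rw [Finset.card_image_of_injOn hAY]
        refine lt_of_lt_of_le (b := L) ?_ hA
        refine lt_of_le_of_lt (natDegree_sum_le_of_forall_le (n := L - 1) _ _ fun l _ => ?_) ?_
        · exact (natDegree_C_mul_X_pow_le _ _).trans (by have := l.1.2; omega)
        · have := l₀.2; omega
    funext l
    have h1 : p.coeff (l.1 : ℕ) = v l := by
      simp only [p, finsetSum_coeff, coeff_C_mul_X_pow]
      rw [Finset.sum_eq_single l]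
      · simp
      · intro m _ hm
        rw [if_neg]
        exact fun h => hm (Subtype.ext (Fin.ext h.symm))
      · simp
    simpa [hp] using h1.symm)
  let D : Matrix S S ℝ[X] := Matrix.of fun l j =>
    (P l.1).comp (Polynomial.X + C (X (γ j).1)) * C (Y (γ j).1 ^ (l.1 : ℕ))
  let deg : S → ℕ := fun l => (P l.1).natDegree
  have hDdeg : ∀ l j, (D l j).natDegree ≤ deg l := by
    intro l j
    refine (natDegree_mul_C_le _ _).trans ?_
    change ((P l.1).comp (Polynomial.X + C (X (γ j).1))).natDegree ≤ _
    rw [natDegree_comp, natDegree_X_add_C, mul_one]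
  have hDcoeff : ∀ l j, (D l j).coeff (deg l) =
      (P l.1).leadingCoeff * Y (γ j).1 ^ (l.1 : ℕ) := by
    intro l j
    simp only [D, Matrix.of_apply, coeff_mul_C]
    congr 1
    have h1 : deg l = ((P l.1).comp (Polynomial.X + C (X (γ j).1))).natDegree := by
      rw [natDegree_comp, natDegree_X_add_C, mul_one]
    rw [h1, coeff_natDegree, leadingCoeff_comp (by rw [natDegree_X_add_C]; exact one_ne_zero)]
    simp
  have hcoeff : D.det.coeff (∑ l, deg l) = (∏ l : S, (P l.1).leadingCoeff) *
      (Matrix.of fun (l j : S) => Y (γ j).1 ^ (l.1 : ℕ)).det := by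
    rw [← Matrix.det_transpose, Matrix.det_apply',
      ← Matrix.det_transpose (Matrix.of fun (l j : S) => Y (γ j).1 ^ (l.1 : ℕ)),
      Matrix.det_apply', finsetSum_coeff, Finset.mul_sum]
    refine Finset.sum_congr rfl fun σ _ => ?_
    rw [← C_eq_intCast, coeff_C_mul]
    simp only [Matrix.transpose_apply]
    rw [coeff_prod_sum_of_natDegree_le _ _ _ fun l _ => hDdeg l _]
    simp only [hDcoeff, Finset.prod_mul_distrib, Matrix.of_apply]
    ring
  have hdet : D.det ≠ 0 := by
    intro h
    rw [h, coeff_zero] at hcoeff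
    refine mul_ne_zero (Finset.prod_ne_zero_iff.2 fun l _ => ?_) hγ hcoeff.symm
    exact leadingCoeff_ne_zero.2 l.2
  apply hdet
  refine Polynomial.eq_zero_of_natDegree_lt_card_of_eval_eq_zero' D.det (B.image X) ?_ ?_
  · intro z hz
    obtain ⟨h, hh, rfl⟩ := Finset.mem_image.1 hz
    rw [← coe_evalRingHom, RingHom.map_det]
    refine Matrix.exists_vecMul_eq_zero_iff.1 ⟨fun l => Y h ^ (l.1 : ℕ), ?_, ?_⟩
    · exact fun h' => pow_ne_zero _ (hY0 h) (congrFun h' ⟨l₀, hl₀⟩)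
    · funext j
      have h1 := h0 (γ j).1 (γ j).2 h hh
      rw [← Finset.sum_subset (Finset.subset_univ (Finset.univ.filter fun l => P l ≠ 0))
        (fun l _ hl => by simp at hl; simp [hl])] at h1
      rw [Finset.sum_subtype (p := fun l => P l ≠ 0) _ (by simp)] at h1
      rw [Pi.zero_apply, ← h1]
      simp only [Matrix.vecMul, dotProduct]
      refine Finset.sum_congr rfl fun l _ => ?_
      simp only [RingHom.mapMatrix_apply, Matrix.map_apply, D, Matrix.of_apply, coe_evalRingHom,
        eval_mul, eval_comp, eval_add, eval_X, eval_C, hX, hY, mul_pow]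
      rw [add_comm (X h)]
      ring
  · rw [Finset.card_image_of_injOn hBX]
    refine lt_of_le_of_lt ?_ hB
    rw [Matrix.det_apply]
    refine natDegree_sum_le_of_forall_le _ _ fun σ _ => ?_
    refine (natDegree_smul_le _ _).trans ((natDegree_prod_le _ _).trans ?_)
    calc ∑ l, (D (σ l) l).natDegree ≤ ∑ _l : S, (K - 1) :=
          Finset.sum_le_sum fun l _ => (hDdeg _ _).trans (hP _)
      _ = Fintype.card S * (K - 1) := by simp
      _ ≤ (K - 1) * L := by
        rw [mul_comm]
        refine Nat.mul_le_mul_left _ ?_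
        exact (Fintype.card_subtype_le _).trans_eq (Fintype.card_fin L)

/-! ### An upper bound for the exponents -/

/-- Two positive numbers at distance at most `250` have close logarithms. -/
lemma abs_log_sub_log_le {u v : ℝ} (hu : 250 < u) (h₁ : u ≤ v + 250) (h₂ : v ≤ u + 250) :
    |Real.log u - Real.log v| ≤ 250 / (u - 250) := by
  have hu0 : 0 < u := by linarith
  have hv0 : 0 < v := by linarith
  rw [abs_le]
  constructor
  · have h := Real.log_le_sub_one_of_pos (div_pos hv0 hu0)
    rw [Real.log_div hv0.ne' hu0.ne'] at h
    have h3 : v / u - 1 ≤ 250 / (u - 250) := by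
      rw [div_sub_one hu0.ne']
      exact div_le_div₀ (by norm_num) (by linarith) (by linarith) (by linarith)
    linarith
  · have h := Real.log_le_sub_one_of_pos (div_pos hu0 hv0)
    rw [Real.log_div hu0.ne' hv0.ne'] at h
    have h3 : u / v - 1 ≤ 250 / (u - 250) := by
      rw [div_sub_one hv0.ne']
      exact div_le_div₀ (by norm_num) (by linarith) (by linarith) (by linarith)
    linarith

/-- The monomial functions `(r, s) ↦ (r * x + s * y) ^ k * (c ^ r * a ^ s) ^ l` with `k < K` and
`l < L` have a nonzero interpolation determinant on the square of side `S + L`. -/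
lemma exists_interpolation_det_ne_zero {a c x y K L S : ℕ} (ha : 2 ≤ a) (hc : 2 ≤ c)
    (hx : 0 < x) (hxy : x.Coprime y) (hS : S ≤ x) (hKL : (K - 1) * L < S * S) :
    ∃ g : Fin K × Fin L → Fin (S + L) × Fin (S + L),
      (Matrix.of fun (i j : Fin K × Fin L) =>
        (((g j).1 * x + (g j).2 * y : ℕ) : ℝ) ^ (i.1 : ℕ) *
          ((c ^ ((g j).1 : ℕ) * a ^ ((g j).2 : ℕ) : ℕ) : ℝ) ^ (i.2 : ℕ)).det ≠ 0 := by
  refine exists_det_ne_zero (fun (g : Fin (S + L) × Fin (S + L)) (i : Fin K × Fin L) =>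
    ((g.1 * x + g.2 * y : ℕ) : ℝ) ^ (i.1 : ℕ) *
      ((c ^ (g.1 : ℕ) * a ^ (g.2 : ℕ) : ℕ) : ℝ) ^ (i.2 : ℕ)) fun v hv => ?_
  let P : Fin L → Polynomial ℝ := fun l =>
    ∑ k : Fin K, Polynomial.C (v (k, l)) * Polynomial.X ^ (k : ℕ)
  have hP := eq_zero_of_eval_eq_zero (G := ℕ × ℕ) (K := K) P
    (fun l => Polynomial.natDegree_sum_le_of_forall_le _ _ fun k _ =>
      (Polynomial.natDegree_C_mul_X_pow_le _ _).trans (by have := k.2; omega))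
    (fun g => ((g.1 * x + g.2 * y : ℕ) : ℝ)) (fun g => ((c ^ g.1 * a ^ g.2 : ℕ) : ℝ))
    (fun g h => by push_cast [Prod.fst_add, Prod.snd_add]; ring)
    (fun g h => by push_cast [Prod.fst_add, Prod.snd_add]; ring)
    (fun g => by positivity)
    (Finset.range L ×ˢ {0}) (Finset.range S ×ˢ Finset.range S) (by simp)
    (by
      rintro ⟨r, s⟩ hg ⟨r', s'⟩ hg' h
      simp only [Finset.coe_product, Finset.coe_singleton, Set.mem_prod,
        Set.mem_singleton_iff] at hg hg'
      obtain ⟨-, rfl⟩ := hg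
      obtain ⟨-, rfl⟩ := hg'
      simp only [pow_zero, mul_one, Nat.cast_inj] at h
      rw [Nat.pow_right_injective hc h])
    (by simpa using hKL)
    (by
      rintro ⟨r, s⟩ hg ⟨r', s'⟩ hg' h
      simp only [Finset.coe_product, Finset.coe_range, Set.mem_prod, Set.mem_Iio] at hg hg'
      have h' : r * x + s * y = r' * x + s' * y := Nat.cast_injective h
      have hmod : s * y ≡ s' * y [MOD x] := by
        have h1 : (r * x + s * y) % x = (r' * x + s' * y) % x := by rw [h']
        simpa [Nat.ModEq, Nat.add_mod] using h1
      have h2 : s ≡ s' [MOD x] := Nat.ModEq.cancel_right_of_coprime hxy hmod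
      have hs : s = s' := Nat.ModEq.eq_of_lt_of_lt h2 (by omega) (by omega)
      subst hs
      rw [Nat.eq_of_mul_eq_mul_right hx (Nat.add_right_cancel h')])
    (by
      rintro ⟨r, s⟩ hg ⟨r', s'⟩ hh
      simp only [Finset.mem_product, Finset.mem_range, Finset.mem_singleton] at hg hh
      obtain ⟨hr, rfl⟩ := hg
      have h1 := hv (⟨r + r', by omega⟩, ⟨0 + s', by omega⟩)
      rw [Fintype.sum_prod_type_right] at h1
      rw [← h1]
      refine Finset.sum_congr rfl fun l _ => ?_
      simp only [P, Polynomial.eval_finsetSum, Polynomial.eval_mul, Polynomial.eval_C,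
        Polynomial.eval_pow, Polynomial.eval_X, Finset.sum_mul, Prod.mk_add_mk, mul_assoc])
  funext ⟨k, l⟩
  have h1 : (P l).coeff (k : ℕ) = v (k, l) := by
    simp only [P, Polynomial.finsetSum_coeff, Polynomial.coeff_C_mul_X_pow]
    rw [Finset.sum_eq_single k]
    · simp
    · intro m _ hm
      rw [if_neg]
      exact fun h => hm (Fin.ext h.symm)
    · simp
  simpa [hP l] using h1.symm

/-- The interpolation determinant is a nonzero integer, hence at least `1` in absolute value, and
it is bounded above because `c ^ r * a ^ s` is nearly `exp (β * (r * x + s * y))` with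
`β = log c / x` when `a ^ x` is nearly `c ^ y`. -/
theorem exp_le_of_log_sub_log_small {a c x y K L S : ℕ} (ha : 2 ≤ a) (hc : 2 ≤ c)
    (hx : 0 < x) (hxy : x.Coprime y) (hS : S ≤ x) (hKL : (K - 1) * L < S * S)
    {ε : ℝ} (hε : Real.exp 1 ^ (K * L) * ε ≤ 1)
    (hδ : 2 * (L * (S + L) * |x * Real.log a - y * Real.log c|) ≤ ε) :
    Real.exp 1 ^ (∑ t ∈ Finset.range (K * L), t) ≤ (K * L).factorial *
      ∏ i : Fin K × Fin L, (2 * ((Real.exp 1 * ((S + L) * (x + y))) ^ (i.1 : ℕ) *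
        Real.exp (i.2 * (Real.log c / x) * (Real.exp 1 * ((S + L) * (x + y)))))) := by
  obtain ⟨g, hg⟩ := exists_interpolation_det_ne_zero ha hc hx hxy hS hKL
  set M : Matrix (Fin K × Fin L) (Fin K × Fin L) ℝ :=
    Matrix.of fun (i j : Fin K × Fin L) =>
        (((g j).1 * x + (g j).2 * y : ℕ) : ℝ) ^ (i.1 : ℕ) *
          ((c ^ ((g j).1 : ℕ) * a ^ ((g j).2 : ℕ) : ℕ) : ℝ) ^ (i.2 : ℕ) with hMdef
  have hx' : (0 : ℝ) < x := by exact_mod_cast hx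
  have hx1 : (1 : ℝ) ≤ x := by exact_mod_cast hx
  have ha' : (0 : ℝ) < a := by positivity
  have hc' : (0 : ℝ) < c := by positivity
  have hone : 1 ≤ |M.det| := by
    let Z : Matrix (Fin K × Fin L) (Fin K × Fin L) ℤ := Matrix.of fun i j =>
        (((g j).1 * x + (g j).2 * y : ℕ) : ℤ) ^ (i.1 : ℕ) *
          ((c ^ ((g j).1 : ℕ) * a ^ ((g j).2 : ℕ) : ℕ) : ℤ) ^ (i.2 : ℕ)
    have hZ : M.det = (Z.det : ℝ) := by
      rw [← eq_intCast (Int.castRingHom ℝ), RingHom.map_det]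
      congr 1
      ext i j
      simp [M, Z]
    rw [hZ] at hg ⊢
    rw [← Int.cast_abs]
    exact_mod_cast Int.one_le_abs (by exact_mod_cast hg)
  have hexp1 : (1 : ℝ) ≤ Real.exp 1 := Real.one_le_exp zero_le_one
  have hlogc : 0 ≤ Real.log c := Real.log_nonneg (by exact_mod_cast (by omega : 1 ≤ c))
  have hε0 : 0 ≤ ε := le_trans (by positivity) hδ
  have hε1 : ε ≤ 1 := by
    refine le_trans ?_ hε
    exact le_mul_of_one_le_left hε0 (one_le_pow₀ hexp1)
  have hbound := pow_mul_abs_det_exp_le M (fun i => (i.1 : ℕ))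
    (fun i => (i.2 : ℕ) * (Real.log c / x))
    (fun j => (((g j).1 * x + (g j).2 * y : ℕ) : ℝ)) ((S + L) * (x + y)) (Real.exp 1) ε hexp1
    (fun i => by positivity) (fun j => by positivity)
    (fun j => by
      have h1 : (((g j).1 : ℕ) : ℝ) ≤ S + L := by exact_mod_cast (g j).1.2.le
      have h2 : (((g j).2 : ℕ) : ℝ) ≤ S + L := by exact_mod_cast (g j).2.2.le
      push_cast
      rw [mul_add]
      gcongr)
    (by simpa using hε) hε0
    (fun i j => by
      set r : ℕ := (g j).1.val
      set s : ℕ := (g j).2.val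
      set δ : ℝ := (x * Real.log a - y * Real.log c) / x with hδdef
      have hentry : ((c ^ r * a ^ s : ℕ) : ℝ) ^ (i.2 : ℕ) =
          Real.exp ((i.2 : ℕ) * (Real.log c / x) * ((r * x + s * y : ℕ) : ℝ)) *
            Real.exp ((i.2 : ℕ) * s * δ) := by
        rw [← Real.exp_add]
        have : (i.2 : ℕ) * (Real.log c / x) * ((r * x + s * y : ℕ) : ℝ) + (i.2 : ℕ) * s * δ =
            (i.2 : ℕ) * (r * Real.log c + s * Real.log a) := by
          rw [hδdef]
          push_cast
          field_simp
          ring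
        rw [this, Real.exp_nat_mul, Real.exp_add, Real.exp_nat_mul, Real.exp_nat_mul,
          Real.exp_log ha', Real.exp_log hc']
        push_cast
        rfl
      have hsmall : 2 * |(i.2 : ℕ) * s * δ| ≤ ε := by
        refine le_trans ?_ hδ
        have h1 : ((i.2 : ℕ) : ℝ) ≤ L := by exact_mod_cast i.2.2.le
        have h2 : (s : ℝ) ≤ S + L := by exact_mod_cast (g j).2.2.le
        have h3 : |δ| ≤ |x * Real.log a - y * Real.log c| := by
          rw [hδdef, abs_div, abs_of_pos hx']
          exact div_le_self (abs_nonneg _) hx1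
        rw [abs_mul, abs_mul, Nat.abs_cast, Nat.abs_cast]
        gcongr
      have hM : M i j = ((r * x + s * y : ℕ) : ℝ) ^ (i.1 : ℕ) *
          ((c ^ r * a ^ s : ℕ) : ℝ) ^ (i.2 : ℕ) := rfl
      rw [hM, hentry, ← mul_assoc, ← mul_sub_one, abs_mul, mul_comm,
        abs_of_nonneg (by positivity : 0 ≤ ((r * x + s * y : ℕ) : ℝ) ^ (i.1 : ℕ) *
          Real.exp ((i.2 : ℕ) * (Real.log c / x) * ((r * x + s * y : ℕ) : ℝ)))]
      refine mul_le_mul_of_nonneg_right (le_trans ?_ hsmall) (by positivity)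
      exact Real.abs_exp_sub_one_le (by linarith))
  have hcard : Fintype.card (Fin K × Fin L) = K * L := by simp
  rw [hcard] at hbound
  refine le_trans ?_ hbound
  exact le_mul_of_one_le_right (by positivity) hone

lemma le_exp_half {L : ℕ} (hL : 100 ≤ L) :
    4 * 10 ^ 6 * (L * ((L : ℝ) + 1) ^ 2) ≤ Real.exp (L / 2) := by
  have hL' : (100 : ℝ) ≤ L := by exact_mod_cast hL
  have h1 := Real.pow_div_factorial_le_exp ((L : ℝ) / 2) (by positivity) 20
  refine le_trans ?_ h1
  rw [le_div_iff₀ (by positivity)]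
  have h2 : (50 : ℝ) ^ 17 ≤ ((L : ℝ) / 2) ^ 17 := pow_le_pow_left₀ (by norm_num) (by linarith) _
  have h3 : ((L : ℝ) + 1) ^ 2 ≤ 2 * L ^ 2 := by nlinarith
  calc 4 * 10 ^ 6 * (L * ((L : ℝ) + 1) ^ 2) * ((20).factorial : ℝ)
      ≤ 4 * 10 ^ 6 * (L * (2 * L ^ 2)) * ((20).factorial : ℝ) := by gcongr
    _ = (L : ℝ) ^ 3 * (8 * 10 ^ 6 * ((20).factorial : ℝ)) := by ring
    _ ≤ (L : ℝ) ^ 3 * (50 ^ 17 / 8) := by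
        refine mul_le_mul_of_nonneg_left ?_ (by positivity)
        norm_num [Nat.factorial]
    _ = ((L : ℝ) / 2) ^ 3 * 50 ^ 17 := by ring
    _ ≤ ((L : ℝ) / 2) ^ 3 * ((L : ℝ) / 2) ^ 17 := by gcongr
    _ = ((L : ℝ) / 2) ^ 20 := by ring

lemma le_of_pow_close {a c x y : ℕ} (hac : a < c) (hx : 250 < a ^ x) (h : c ^ y ≤ a ^ x + 250) :
    y ≤ x := by
  by_contra! hyx
  have hc : 2 ≤ c := by
    by_contra! hc
    have : a ^ x ≤ 1 := pow_le_one₀ (by omega) (by omega)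
    omega
  have h2 : a ^ x * 2 ≤ c ^ y :=
    calc a ^ x * 2 ≤ c ^ x * c := Nat.mul_le_mul (Nat.pow_le_pow_left hac.le _) hc
      _ = c ^ (x + 1) := (pow_succ _ _).symm
      _ ≤ c ^ y := Nat.pow_le_pow_right (by omega) hyx
  omega

lemma sum_fin_val_le (n : ℕ) : ∑ i : Fin n, ((i : ℕ) : ℝ) ≤ (n : ℝ) ^ 2 / 2 := by
  rw [Fin.sum_univ_eq_sum_range (fun i => (i : ℝ))]
  induction n with
  | zero => simp
  | succ n ih =>
    rw [Finset.sum_range_succ]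
    push_cast
    nlinarith

lemma log_le_of_le_250 {n : ℕ} (hn : 0 < n) (h : n ≤ 250) : Real.log n ≤ 5.546 := by
  have h1 : Real.log n ≤ Real.log (2 ^ 8) :=
    Real.log_le_log (by exact_mod_cast hn) (by exact_mod_cast (by omega : n ≤ 2 ^ 8))
  rw [Real.log_pow] at h1
  have := Real.log_two_lt_d9
  push_cast at h1
  linarith

/-- With `N = 4900 * L ^ 2` interpolation points, `log |a ^ x / c ^ y|` beats the precision
`exp (-N)` demanded by the determinant bound as soon as `x ≥ 10000 * L ^ 2`. -/
lemma log_sub_log_small {a c x y L : ℕ} (ha : 2 ≤ a) (hL : 100 ≤ L)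
    (hx : 10000 * (L * L) ≤ x) (h₁ : a ^ x ≤ c ^ y + 250) (h₂ : c ^ y ≤ a ^ x + 250) :
    2 * (L * ((70 * L : ℕ) + L) * |x * Real.log a - y * Real.log c|) ≤
      (Real.exp 1 ^ (4900 * L * L))⁻¹ := by
  have hLL : 10000 ≤ L * L := Nat.mul_le_mul hL hL
  -- `7350 * L ^ 2` is a bound for `log₂ (exp N)`, since `exp 2 ≤ 2 ^ 3`.
  have hpow : 2 ^ (7351 * (L * L) + 16) + 250 ≤ a ^ x := by
    calc 2 ^ (7351 * (L * L) + 16) + 250 ≤ 2 ^ (7351 * (L * L) + 16) + 2 ^ 8 := by omega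
      _ ≤ 2 ^ (7351 * (L * L) + 16) + 2 ^ (7351 * (L * L) + 16) :=
        Nat.add_le_add_left (Nat.pow_le_pow_right (by norm_num) (by omega)) _
      _ = 2 ^ (7351 * (L * L) + 17) := by ring
      _ ≤ 2 ^ x := Nat.pow_le_pow_right (by norm_num) (by omega)
      _ ≤ a ^ x := Nat.pow_le_pow_left ha _
  have hpow' : (2 : ℝ) ^ (7351 * (L * L) + 16) + 250 ≤ (a : ℝ) ^ x := by exact_mod_cast hpow
  have hΛ : |x * Real.log a - y * Real.log c| ≤ 250 / ((a : ℝ) ^ x - 250) := by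
    rw [← Real.log_pow, ← Real.log_pow]
    refine abs_log_sub_log_le ?_ (by exact_mod_cast h₁) (by exact_mod_cast h₂)
    have : (0 : ℝ) < 2 ^ (7351 * (L * L) + 16) := by positivity
    linarith
  have he : Real.exp 1 ^ (4900 * L * L) ≤ 2 ^ (7350 * (L * L)) := by
    have h1 : Real.exp 1 ^ 2 ≤ 2 ^ 3 := by
      have := Real.exp_one_lt_d9
      have := Real.exp_pos 1
      nlinarith
    calc Real.exp 1 ^ (4900 * L * L) = (Real.exp 1 ^ 2) ^ (2450 * (L * L)) := by
          rw [← pow_mul]; congr 1; ring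
      _ ≤ (2 ^ 3) ^ (2450 * (L * L)) := pow_le_pow_left₀ (by positivity) h1 _
      _ = 2 ^ (7350 * (L * L)) := by rw [← pow_mul]; congr 1; ring
  have hLp : ((L : ℝ) * L) ≤ 2 ^ (L * L) := by exact_mod_cast (L * L).lt_two_pow_self.le
  have hΛ' : |x * Real.log a - y * Real.log c| ≤ 250 / 2 ^ (7351 * (L * L) + 16) :=
    hΛ.trans (div_le_div_of_nonneg_left (by norm_num) (by positivity) (by linarith))
  rw [← one_div, le_div_iff₀ (by positivity)]
  calc 2 * (L * ((70 * L : ℕ) + L) * |x * Real.log a - y * Real.log c|) *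
        Real.exp 1 ^ (4900 * L * L)
      ≤ 2 * (L * ((70 * L : ℕ) + L) * (250 / 2 ^ (7351 * (L * L) + 16))) *
        2 ^ (7350 * (L * L)) := by gcongr
    _ = 35500 * ((L : ℝ) * L) / (2 ^ (L * L) * 2 ^ 16) := by
        have h3 : (2 : ℝ) ^ (7351 * (L * L) + 16) =
            2 ^ (7350 * (L * L)) * (2 ^ (L * L) * 2 ^ 16) := by
          rw [← pow_add, ← pow_add]; congr 1; ring
        rw [h3]
        push_cast
        field_simp
        ring
    _ ≤ 1 := by
        rw [div_le_one (by positivity)]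
        nlinarith

/-- Bounds for the nodes of the interpolation problem on the square of side `71 * L`, scaled
by `exp 1`. -/
lemma node_le {a c x y L : ℕ} (ha : 2 ≤ a) (ha' : a ≤ 250) (hc : 0 < c) (hc' : c ≤ 250)
    (hyx : y ≤ x) (hL : 100 ≤ L) (hx : 10 ^ 8 ≤ x) (hxL : x ≤ 10000 * ((L + 1) * (L + 1)))
    (h : c ^ y ≤ a ^ x + 250) :
    Real.exp 1 * (((70 * L : ℕ) + L) * (x + y)) ≤ Real.exp (L / 2) ∧
      Real.log c / x * (Real.exp 1 * (((70 * L : ℕ) + L) * (x + y))) ≤ 2143 * L := by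
  have hLr : (0 : ℝ) < L := by exact_mod_cast (by omega : 0 < L)
  have hxbig : (10 : ℝ) ^ 8 ≤ x := by exact_mod_cast hx
  have hxr : (0 : ℝ) < x := by linarith
  have hyr : (y : ℝ) ≤ x := by exact_mod_cast hyx
  have hxLr : (x : ℝ) ≤ 10000 * ((L + 1) * (L + 1)) := by exact_mod_cast hxL
  have he := Real.exp_one_lt_d9
  constructor
  · refine le_trans ?_ (le_exp_half hL)
    calc Real.exp 1 * (((70 * L : ℕ) + L) * (x + y))
        ≤ 2.8 * ((71 * L) * (2 * (10000 * ((L + 1) * (L + 1))))) := by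
          push_cast
          refine mul_le_mul (by linarith) ?_ (by positivity) (by norm_num)
          exact mul_le_mul (by linarith) (by linarith) (by positivity) (by positivity)
      _ = 3976000 * (L * ((L : ℝ) + 1) ^ 2) := by ring
      _ ≤ 4 * 10 ^ 6 * (L * ((L : ℝ) + 1) ^ 2) :=
          mul_le_mul_of_nonneg_right (by norm_num) (by positivity)
  · have hloga := log_le_of_le_250 (by omega) ha'
    have hlogc := log_le_of_le_250 hc hc'
    have hy : y * Real.log c ≤ x * Real.log a + 1 := by
      have h2 : 2 ^ 8 ≤ a ^ x :=
        (Nat.pow_le_pow_left ha 8).trans (Nat.pow_le_pow_right (by omega) (by omega))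
      have h3 : ((c : ℝ) ^ y) ≤ 2 * a ^ x := by exact_mod_cast (by omega : c ^ y ≤ 2 * a ^ x)
      have h4 := Real.log_le_log (by positivity) h3
      rw [Real.log_mul (by norm_num) (by positivity), Real.log_pow, Real.log_pow] at h4
      linarith [Real.log_two_lt_d9]
    have h5 : (x + y) * Real.log c ≤ 11.1 * x := by
      have h6 := mul_le_mul_of_nonneg_left hloga hxr.le
      have h7 := mul_le_mul_of_nonneg_left hlogc hxr.le
      linarith
    calc Real.log c / x * (Real.exp 1 * (((70 * L : ℕ) + L) * (x + y)))
        = Real.exp 1 * (71 * L) * ((x + y) * Real.log c / x) := by push_cast; ring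
      _ ≤ 2.7182818286 * (71 * L) * 11.1 := by
          gcongr
          rwa [div_le_iff₀ hxr]
      _ ≤ 2143 * L := by linarith

/-- With `ρ` and `b * ρ` as bounded in `node_le`, the exponent is `N` times about `2296.5 * L ^ 2`,
less than the `N * (N - 1) / 2` gained from the order of vanishing, where `N = 4900 * L ^ 2`. -/
lemma prod_pow_mul_exp_le {L : ℕ} {ρ b : ℝ} (hρ0 : 0 ≤ ρ) (hρ : ρ ≤ Real.exp (L / 2))
    (hb : b * ρ ≤ 2143 * L) :
    ∏ i : Fin (4900 * L) × Fin L, (2 * (ρ ^ (i.1 : ℕ) * Real.exp (i.2 * b * ρ))) ≤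
      Real.exp (4900 * L ^ 2 * (1 + 2296.5 * L ^ 2)) := by
  have hterm : ∀ i : Fin (4900 * L) × Fin L,
      2 * (ρ ^ (i.1 : ℕ) * Real.exp (i.2 * b * ρ)) ≤
        Real.exp (1 + (i.1 : ℕ) * (L / 2) + (i.2 : ℕ) * (2143 * L)) := by
    intro i
    have h2 : (2 : ℝ) ≤ Real.exp 1 := by linarith [Real.add_one_le_exp (1 : ℝ)]
    have h3 : ρ ^ (i.1 : ℕ) ≤ Real.exp ((i.1 : ℕ) * (L / 2)) := by
      rw [Real.exp_nat_mul]
      exact pow_le_pow_left₀ hρ0 hρ _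
    rw [Real.exp_add, Real.exp_add, mul_assoc (Real.exp 1), mul_assoc ((i.2 : ℕ) : ℝ)]
    gcongr
  refine (Finset.prod_le_prod (fun i _ => by positivity) fun i _ => hterm i).trans ?_
  rw [← Real.exp_sum, Real.exp_le_exp, Finset.sum_add_distrib, Finset.sum_add_distrib,
    ← Finset.sum_mul, ← Finset.sum_mul, Fintype.sum_prod_type, Fintype.sum_prod_type,
    Fintype.sum_prod_type]
  have h3 := sum_fin_val_le (4900 * L)
  have h4 := sum_fin_val_le L
  simp only [Finset.sum_const, Finset.card_univ, Fintype.card_fin, nsmul_eq_mul,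
    ← Finset.mul_sum, mul_one]
  push_cast at h3 ⊢
  calc 4900 * (L : ℝ) * L + L * (∑ i : Fin (4900 * L), ((i : ℕ) : ℝ)) * (L / 2)
        + 4900 * L * (∑ i : Fin L, ((i : ℕ) : ℝ)) * (2143 * L)
      ≤ 4900 * (L : ℝ) * L + L * ((4900 * L) ^ 2 / 2) * (L / 2)
        + 4900 * L * ((L : ℝ) ^ 2 / 2) * (2143 * L) := by gcongr
    _ = 4900 * L ^ 2 * (1 + 2296.5 * L ^ 2) := by ring

/-- Nearly equal powers of distinct bases up to `250` with coprime exponents have exponents below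
`10 ^ 8`. With `x ≈ 10000 * L ^ 2`, the interpolation determinant for `K = 4900 * L` on the square
of side `71 * L` would otherwise be a nonzero integer smaller than `1`. -/
theorem exponent_lt_of_coprime {a c x y : ℕ} (ha : 2 ≤ a) (hac : a < c) (hc : c ≤ 250)
    (hxy : x.Coprime y) (h₁ : a ^ x ≤ c ^ y + 250) (h₂ : c ^ y ≤ a ^ x + 250) :
    x < 10 ^ 8 := by
  by_contra! hx
  have hpow : 2 ^ 8 ≤ a ^ x :=
    (Nat.pow_le_pow_left ha 8).trans (Nat.pow_le_pow_right (by omega) (by omega))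
  have hyx : y ≤ x := le_of_pow_close hac (by omega) h₂
  obtain ⟨L, hL, hLx, hxL⟩ : ∃ L, 100 ≤ L ∧ 10000 * (L * L) ≤ x ∧
      x ≤ 10000 * ((L + 1) * (L + 1)) := by
    refine ⟨Nat.sqrt (x / 10000), Nat.le_sqrt.2 (by omega), ?_, ?_⟩
    · have := Nat.sqrt_le (x / 10000)
      omega
    · have := Nat.lt_succ_sqrt (x / 10000)
      simp only [Nat.succ_eq_add_one] at this
      omega
  have hLx' : 70 * L ≤ x := le_trans (by nlinarith) hLx
  have hmain := exp_le_of_log_sub_log_small (K := 4900 * L) (S := 70 * L) ha (by omega)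
    (by omega) hxy hLx' (by
      calc (4900 * L - 1) * L < 4900 * L * L :=
            Nat.mul_lt_mul_of_pos_right (by omega) (by omega)
        _ = 70 * L * (70 * L) := by ring)
    mul_inv_le_one (log_sub_log_small ha hL hLx h₁ h₂)
  obtain ⟨hρ, hβ⟩ := node_le ha (by omega) (by omega) hc hyx hL hx hxL h₂
  have hprod := prod_pow_mul_exp_le (by positivity) hρ hβ
  have hLr : (100 : ℝ) ≤ L := by exact_mod_cast hL
  generalize hN : 4900 * L * L = N at hmain
  have hNr : (N : ℝ) = 4900 * L ^ 2 := by rw [← hN]; push_cast; ring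
  have hN1 : 1 ≤ N := by rw [← hN]; nlinarith
  have hNe : (N : ℝ) ≤ Real.exp (L / 2) := by
    refine le_trans ?_ (le_exp_half hL)
    rw [hNr]
    calc 4900 * (L : ℝ) ^ 2 ≤ 4 * 10 ^ 6 * (L * L) := by
          rw [← sq]; gcongr; norm_num
      _ ≤ 4 * 10 ^ 6 * (L * ((L : ℝ) + 1) ^ 2) := by gcongr; nlinarith
  have hfac : (N.factorial : ℝ) ≤ Real.exp (4900 * L ^ 2 * (L / 2)) := by
    calc (N.factorial : ℝ) ≤ (N : ℝ) ^ N := by exact_mod_cast N.factorial_le_pow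
      _ ≤ Real.exp (L / 2) ^ N := pow_le_pow_left₀ (by positivity) hNe _
      _ = Real.exp (4900 * L ^ 2 * (L / 2)) := by rw [← Real.exp_nat_mul, hNr]
  have hlhs : Real.exp 1 ^ (∑ t ∈ Finset.range N, t) =
      Real.exp (4900 * L ^ 2 * ((4900 * L ^ 2 - 1) / 2)) := by
    rw [← Real.exp_nat_mul, mul_one]
    congr 1
    have h3 := Finset.sum_range_id_mul_two N
    have h4 : (((∑ t ∈ Finset.range N, t) * 2 : ℕ) : ℝ) = N * (N - 1) := by
      rw [h3, Nat.cast_mul, Nat.cast_sub hN1, Nat.cast_one]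
    rw [Nat.cast_mul, hNr] at h4
    push_cast at h4 ⊢
    linarith
  rw [hlhs] at hmain
  have hfin := hmain.trans (mul_le_mul hfac hprod
    (Finset.prod_nonneg fun i _ => by positivity) (by positivity))
  rw [← Real.exp_add, Real.exp_le_exp, ← mul_add] at hfin
  have := le_of_mul_le_mul_left hfin (by positivity)
  nlinarith

/-- Distinct `d`-th powers of positive integers, `d ≥ 2`, are far apart. -/
lemma pow_le_mul_self_of_pow_close {p q d m : ℕ} (hd : 2 ≤ d) (hp : 0 < p)
    (hpq : p ≠ q) (h₁ : p ^ d ≤ q ^ d + m) (h₂ : q ^ d ≤ p ^ d + m) : p ^ d ≤ m * m := by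
  have key : ∀ u v : ℕ, u < v → v ^ d ≤ u ^ d + m → v ^ (d - 1) ≤ m := by
    intro u v huv h
    obtain ⟨e, rfl⟩ : ∃ e, d = e + 1 := ⟨d - 1, by omega⟩
    have h3 : u ^ (e + 1) + v ^ e ≤ v ^ (e + 1) :=
      calc u ^ (e + 1) + v ^ e = u ^ e * u + v ^ e := by rw [pow_succ]
        _ ≤ v ^ e * u + v ^ e := by gcongr
        _ = v ^ e * (u + 1) := by ring
        _ ≤ v ^ e * v := Nat.mul_le_mul_left _ huv
        _ = v ^ (e + 1) := (pow_succ _ _).symm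
    simp only [Nat.add_sub_cancel]
    omega
  have h4 : p ^ (d - 1) ≤ m := by
    rcases lt_or_gt_of_ne hpq with h | h
    · exact (Nat.pow_le_pow_left h.le _).trans (key p q h h₂)
    · exact key q p h h₁
  calc p ^ d ≤ p ^ ((d - 1) + (d - 1)) := Nat.pow_le_pow_right hp (by omega)
    _ = p ^ (d - 1) * p ^ (d - 1) := pow_add _ _ _
    _ ≤ m * m := Nat.mul_le_mul h4 h4

/-- The coprimality assumption of `exponent_lt_of_coprime` can be dropped for different powers. -/
theorem exponent_lt {a c x y : ℕ} (ha : 2 ≤ a) (hac : a < c) (hc : c ≤ 250)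
    (hne : a ^ x ≠ c ^ y) (h₁ : a ^ x ≤ c ^ y + 250) (h₂ : c ^ y ≤ a ^ x + 250) :
    x < 10 ^ 8 := by
  by_contra! hx
  have hpow : 2 ^ 16 ≤ a ^ x :=
    (Nat.pow_le_pow_left ha 16).trans (Nat.pow_le_pow_right (by omega) (by omega))
  obtain ⟨x', hx'⟩ := Nat.gcd_dvd_left x y
  obtain ⟨y', hy'⟩ := Nat.gcd_dvd_right x y
  have hgpos : 0 < x.gcd y := Nat.gcd_pos_of_pos_left _ (by omega)
  rcases Nat.lt_or_ge (x.gcd y) 2 with hg | hg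
  · have h3 : x.Coprime y := by
      show x.gcd y = 1
      omega
    exact absurd (exponent_lt_of_coprime ha hac hc h3 h₁ h₂) (by omega)
  · generalize x.gcd y = d at *
    subst hx' hy'
    rw [mul_comm d x', mul_comm d y', pow_mul, pow_mul] at *
    have := pow_le_mul_self_of_pow_close hg (by positivity)
      (fun h => hne (by rw [h])) h₁ h₂
    omega

/-! ### Rational approximations to logarithms -/

/-- `33` terms of the series `log ((n + 1) / n) = ∑ 2 / ((2 * k + 1) * (2 * n + 1) ^ (2 * k + 1))`,
scaled by `2 ^ 100` and rounded down term by term. The recursor is used directly, here and in the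
functions below, because the kernel evaluates them. -/
def logInc (n : ℕ) : ℕ :=
  Nat.rec 0 (fun k s => s + 2 ^ 101 / ((2 * k + 1) * (2 * n + 1) ^ (2 * k + 1))) 33

/-- `A` approximates `2 ^ 100 * log m` from below, with an error that grows by at most `34` from
each `m` to the next. -/
def IsLogApprox (m A : ℕ) : Prop :=
  (A : ℝ) ≤ 2 ^ 100 * Real.log m ∧ 2 ^ 100 * Real.log m ≤ A + 34 * m

lemma logInc_eq_sum (n : ℕ) : logInc n =
    ∑ k ∈ Finset.range 33, 2 ^ 101 / ((2 * k + 1) * (2 * n + 1) ^ (2 * k + 1)) := by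
  have : ∀ N : ℕ, (Nat.rec 0 (fun k s => s + 2 ^ 101 / ((2 * k + 1) * (2 * n + 1) ^ (2 * k + 1)))
      N : ℕ) = ∑ k ∈ Finset.range N, 2 ^ 101 / ((2 * k + 1) * (2 * n + 1) ^ (2 * k + 1)) := by
    intro N
    induction N with
    | zero => rfl
    | succ N ih => rw [Finset.sum_range_succ, ← ih]
  exact this 33

lemma logInc_le_and_le {n : ℕ} (hn : 1 ≤ n) :
    (logInc n : ℝ) ≤ 2 ^ 100 * (Real.log (n + 1) - Real.log n) ∧
      2 ^ 100 * (Real.log (n + 1) - Real.log n) ≤ logInc n + 34 := by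
  have hn' : (1 : ℝ) ≤ n := by exact_mod_cast hn
  have hn0 : (0 : ℝ) < n := by linarith
  let t : ℕ → ℝ := fun k =>
    2 ^ 100 * (2 * (1 / (2 * k + 1)) * (1 / (2 * (n : ℝ) + 1)) ^ (2 * k + 1))
  have ht : HasSum t (2 ^ 100 * (Real.log (n + 1) - Real.log n)) := by
    have h := (Real.hasSum_log_one_add_inv hn0).mul_left ((2 : ℝ) ^ 100)
    have h2 : 1 + (n : ℝ)⁻¹ = (n + 1) / n := by field_simp
    rwa [h2, Real.log_div (by positivity) hn0.ne'] at h
  have htq : ∀ k, t k =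
      ((2 ^ 101 : ℕ) : ℝ) / (((2 * k + 1) * (2 * n + 1) ^ (2 * k + 1) : ℕ) : ℝ) := by
    intro k
    simp only [t]
    push_cast
    rw [one_div_pow]
    field_simp
    norm_num
  have ht0 : ∀ k, 0 ≤ t k := fun k => by simp only [t]; positivity
  have hlow : (logInc n : ℝ) ≤ ∑ k ∈ Finset.range 33, t k := by
    rw [logInc_eq_sum, Nat.cast_sum]
    refine Finset.sum_le_sum fun k _ => ?_
    rw [htq]
    exact Nat.cast_div_le
  have hupp : ∑ k ∈ Finset.range 33, t k ≤ logInc n + 33 := by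
    rw [logInc_eq_sum, Nat.cast_sum]
    calc ∑ k ∈ Finset.range 33, t k ≤ ∑ k ∈ Finset.range 33,
          (((2 ^ 101 / ((2 * k + 1) * (2 * n + 1) ^ (2 * k + 1)) : ℕ) : ℝ) + 1) := by
          refine Finset.sum_le_sum fun k _ => ?_
          rw [htq, ← Nat.floor_div_eq_div (K := ℝ)]
          exact (Nat.lt_floor_add_one _).le
      _ = _ := by rw [Finset.sum_add_distrib]; simp
  refine ⟨hlow.trans (sum_le_hasSum _ (fun k _ => ht0 k) ht), ?_⟩
  -- Rounding costs at most `33`, and the terms from `k = 33` on add up to at most `1`.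
  have htail := (hasSum_nat_add_iff' 33).2 ht
  have hgeo : HasSum (fun k => (2 : ℝ) ^ 101 / 3 ^ 67 * (1 / 9) ^ k)
      (2 ^ 101 / 3 ^ 67 * (1 - 1 / 9)⁻¹) :=
    (hasSum_geometric_of_lt_one (by norm_num) (by norm_num)).mul_left _
  have h1 := hasSum_le (fun k => ?_) htail hgeo
  · have h2 : (2 : ℝ) ^ 101 / 3 ^ 67 * (1 - 1 / 9)⁻¹ ≤ 1 := by norm_num
    linarith
  · simp only [t]
    have h3 : (1 / (2 * (n : ℝ) + 1)) ^ (2 * (k + 33) + 1) ≤ (1 / 3) ^ (2 * (k + 33) + 1) := by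
      refine pow_le_pow_left₀ (by positivity) ?_ _
      exact one_div_le_one_div_of_le (by norm_num) (by linarith)
    have h4 : 1 / (2 * ((k + 33 : ℕ) : ℝ) + 1) ≤ 1 := by
      rw [div_le_one (by positivity)]
      have : (0 : ℝ) ≤ ((k + 33 : ℕ) : ℝ) := by positivity
      linarith
    calc (2 : ℝ) ^ 100 * (2 * (1 / (2 * ((k + 33 : ℕ) : ℝ) + 1)) *
          (1 / (2 * (n : ℝ) + 1)) ^ (2 * (k + 33) + 1))
        ≤ 2 ^ 100 * (2 * 1 * (1 / 3) ^ (2 * (k + 33) + 1)) := by gcongr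
      _ = 2 ^ 101 / 3 ^ 67 * (1 / 9) ^ k := by
          have h5 : ((1 : ℝ) / 9) ^ k = (1 / 3) ^ (2 * k) := by rw [pow_mul]; norm_num
          rw [h5]
          have h6 : 2 * (k + 33) + 1 = 2 * k + 67 := by ring
          rw [h6, pow_add]
          norm_num
          ring

lemma IsLogApprox.succ {m A : ℕ} (hm : 1 ≤ m) (h : IsLogApprox m A) :
    IsLogApprox (m + 1) (A + logInc m) := by
  have h1 := logInc_le_and_le hm
  unfold IsLogApprox at *
  push_cast
  constructor <;> linarith [h.1, h.2, h1.1, h1.2]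

lemma isLogApprox_one : IsLogApprox 1 0 := by
  constructor <;> simp

/-! ### Best approximations by the Euclidean algorithm -/

/-- Given consecutive remainders `r₀`, `r₁` of the Euclidean algorithm and the corresponding
denominators `q₀`, `q₁` of convergents, the remainder `r₁` at the first step where the next
denominator exceeds `B`, or `0` if this takes `fuel` steps. -/
def euclidRem (B fuel : ℕ) : ℕ → ℕ → ℕ → ℕ → ℕ :=
  Nat.rec (fun _ _ _ _ => 0)
    (fun _ ih q₀ q₁ r₀ r₁ =>
      Bool.rec r₁
        (ih q₁ (Nat.add q₀ (Nat.mul (Nat.div r₀ r₁) q₁)) r₁ (Nat.mod r₀ r₁))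
        (Nat.ble (Nat.add q₀ (Nat.mul (Nat.div r₀ r₁) q₁)) B)) fuel

lemma euclidRem_succ (B n q₀ q₁ r₀ r₁ : ℕ) : euclidRem B (n + 1) q₀ q₁ r₀ r₁ =
    if q₀ + r₀ / r₁ * q₁ ≤ B then euclidRem B n q₁ (q₀ + r₀ / r₁ * q₁) r₁ (r₀ % r₁) else r₁ := by
  have h : euclidRem B (n + 1) q₀ q₁ r₀ r₁ =
      Bool.rec r₁ (euclidRem B n q₁ (q₀ + r₀ / r₁ * q₁) r₁ (r₀ % r₁))
        (Nat.ble (q₀ + r₀ / r₁ * q₁) B) := rfl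
  rw [h]
  cases hb : Nat.ble (q₀ + r₀ / r₁ * q₁) B with
  | true => rw [if_pos (Nat.le_of_ble_eq_true hb)]
  | false => rw [if_neg fun h => by rw [Nat.ble_eq_true_of_le h] at hb; cases hb]

/-- The law of best approximation for one step of the Euclidean algorithm. -/
lemma le_abs_of_consecutive {A C q₁ q₂ p₁ p₂ r₁ r₂ s t x y : ℤ} (hs : s = 1 ∨ s = -1)
    (ht : t = 1 ∨ t = -1) (h₁ : s * (q₁ * A - p₁ * C) = r₁) (h₂ : s * (q₂ * A - p₂ * C) = -r₂)
    (hdet : q₁ * p₂ - q₂ * p₁ = t) (hq₁ : 0 ≤ q₁) (hr₁ : 0 ≤ r₁) (hr₂ : 0 ≤ r₂) (hx : 0 < x)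
    (hxq : x < q₂) : r₁ ≤ |x * A - y * C| := by
  have ht2 : t * t = 1 := by rcases ht with h | h <;> rw [h] <;> norm_num
  obtain ⟨m, n, hxm, hym⟩ : ∃ m n : ℤ, x = m * q₁ + n * q₂ ∧ y = m * p₁ + n * p₂ := by
    refine ⟨t * (x * p₂ - y * q₂), t * (q₁ * y - p₁ * x), ?_, ?_⟩
    · linear_combination (-x) * ht2 + (-t * x) * hdet
    · linear_combination (-y) * ht2 + (-t * y) * hdet
  have hval : s * (x * A - y * C) = m * r₁ - n * r₂ := by
    rw [hxm, hym]
    linear_combination m * h₁ + n * h₂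
  have habs : |x * A - y * C| = |m * r₁ - n * r₂| := by
    rw [← hval, abs_mul]
    rcases hs with h | h <;> simp [h]
  rw [habs]
  rcases lt_trichotomy n 0 with hn | hn | hn
  · have hm : 0 < m := by
      by_contra! hm
      nlinarith
    refine le_trans ?_ (le_abs_self _)
    nlinarith
  · subst hn
    have hm : m ≠ 0 := by rintro rfl; simp at hxm; omega
    have := Int.one_le_abs hm
    rw [zero_mul, sub_zero, abs_mul, abs_of_nonneg hr₁]
    nlinarith
  · have hm : m < 0 := by
      by_contra! hm
      nlinarith [mul_nonneg hm hq₁]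
    refine le_trans ?_ (neg_le_abs _)
    nlinarith

lemma euclidRem_le_abs {B : ℕ} {A C : ℤ} (n : ℕ) : ∀ {q₀ q₁ r₀ r₁ : ℕ} {p₀ p₁ s t : ℤ},
    (s = 1 ∨ s = -1) → (t = 1 ∨ t = -1) → s * (q₀ * A - p₀ * C) = -r₀ →
    s * (q₁ * A - p₁ * C) = r₁ → q₁ * p₀ - q₀ * p₁ = t →
    ∀ x y : ℤ, 0 < x → x ≤ B → (euclidRem B n q₀ q₁ r₀ r₁ : ℤ) ≤ |x * A - y * C| := by
  induction n with
  | zero => intros; exact abs_nonneg _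
  | succ n ih =>
    intro q₀ q₁ r₀ r₁ p₀ p₁ s t hs ht h₀ h₁ hdet x y hx hxB
    have hr : (r₀ : ℤ) = (r₀ / r₁ : ℕ) * r₁ + (r₀ % r₁ : ℕ) := by
      exact_mod_cast (Nat.div_add_mod' r₀ r₁).symm
    generalize hk : r₀ / r₁ = k at hr
    have h₂ : s * (((q₀ + k * q₁ : ℕ) : ℤ) * A - (p₀ + k * p₁) * C) = -(r₀ % r₁ : ℕ) := by
      push_cast at hr ⊢
      linear_combination h₀ + (k : ℤ) * h₁ - hr
    have hdet₂ : (q₁ : ℤ) * (p₀ + k * p₁) - ((q₀ + k * q₁ : ℕ) : ℤ) * p₁ = t := by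
      push_cast
      linear_combination hdet
    rw [euclidRem_succ, hk]
    split_ifs with hB
    · refine ih (s := -s) (t := -t) (p₀ := p₁) (p₁ := p₀ + k * p₁) (by omega) (by omega)
        ?_ ?_ ?_ x y hx hxB
      · linear_combination -h₁
      · linear_combination -h₂
      · linear_combination -hdet₂
    · refine le_abs_of_consecutive hs ht h₁ h₂ hdet₂ (by positivity) (by positivity)
        (by positivity) hx ?_
      omega

/-! ### Enumeration of small near coincidences of powers -/

/-- The tuples `(a, c, x₁, y₁, x₂, y₂)` with `a < c` and `a ^ x₁ - c ^ y₁ = a ^ x₂ - c ^ y₂` for two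
pairs of positive exponents, the common difference being at most `250` in absolute value. -/
def solutionPairs : List (ℕ × ℕ × ℕ × ℕ × ℕ × ℕ) :=
  [(2, 3, 1, 1, 3, 2), (2, 3, 3, 1, 5, 3), (2, 3, 4, 1, 8, 5), (2, 5, 3, 1, 7, 3),
   (2, 6, 1, 1, 5, 2), (2, 91, 1, 1, 13, 2), (3, 4, 1, 2, 5, 4), (3, 13, 1, 1, 7, 3),
   (3, 16, 1, 1, 5, 2), (6, 15, 1, 1, 3, 2)]

/-- Conjunction of the values of `p` below `n`. -/
def allBelow (n : ℕ) (p : ℕ → Bool) : Bool :=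
  Nat.rec true (fun i ih => Bool.rec false ih (p i)) n

lemma allBelow_eq_true {n : ℕ} {p : ℕ → Bool} (h : allBelow n p = true) :
    ∀ i < n, p i = true := by
  induction n with
  | zero => intro i hi; omega
  | succ n ih =>
    have h' : Bool.rec false (allBelow n p) (p n) = true := h
    intro i hi
    cases hp : p n with
    | false => rw [hp] at h'; cases h'
    | true =>
      rw [hp] at h'
      rcases Nat.lt_succ_iff_lt_or_eq.1 hi with h1 | rfl
      · exact ih h' i h1
      · exact hp

lemma allBelow_of_forall {n : ℕ} {p : ℕ → Bool} (h : ∀ i < n, p i = true) :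
    allBelow n p = true := by
  induction n with
  | zero => rfl
  | succ n ih =>
    show Bool.rec false (allBelow n p) (p n) = true
    rw [h n n.lt_succ_self]
    exact ih fun i hi => h i (hi.trans n.lt_succ_self)

/-- Every pair of smaller positive exponents that yields the same difference as `(x, y)` is
recorded in `solutionPairs`. -/
def checkEarlier (a c x y : ℕ) : Bool :=
  allBelow (x - 1) fun x₁ => allBelow (y - 1) fun y₁ =>
    Bool.rec true (decide ((a, c, x₁ + 1, y₁ + 1, x, y) ∈ solutionPairs))
      (Nat.beq (a ^ (x₁ + 1) + c ^ y) (a ^ x + c ^ (y₁ + 1)))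

lemma mem_of_checkEarlier {a c x y x₁ y₁ : ℕ} (h : checkEarlier a c x y = true) (hx₁ : 1 ≤ x₁)
    (hx : x₁ < x) (hy₁ : 1 ≤ y₁) (hy : y₁ < y) (heq : a ^ x₁ + c ^ y = a ^ x + c ^ y₁) :
    (a, c, x₁, y₁, x, y) ∈ solutionPairs := by
  have h1 := allBelow_eq_true (allBelow_eq_true h (x₁ - 1) (by omega)) (y₁ - 1) (by omega)
  rw [Nat.sub_add_cancel hx₁, Nat.sub_add_cancel hy₁, heq,
    show Nat.beq (a ^ x + c ^ y₁) (a ^ x + c ^ y₁) = true from Nat.beq_refl _] at h1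
  exact of_decide_eq_true h1

/-- Runs `checkEarlier` on the exponents `y, y + 1, …` while the power `v = c ^ y` is at most
`u + 250`, and fails if this takes `fuel` steps. -/
def scan (a c x u fuel : ℕ) : ℕ → ℕ → Bool :=
  Nat.rec (fun _ _ => false)
    (fun _ ih y v =>
      Bool.rec true (Bool.rec false (ih (Nat.succ y) (Nat.mul v c)) (checkEarlier a c x y))
        (Nat.ble v (Nat.add u 250))) fuel

lemma checkEarlier_of_scan {a c x u : ℕ} (hc : 1 ≤ c) (n : ℕ) : ∀ {y : ℕ},
    scan a c x u n y (c ^ y) = true → ∀ y' ≥ y, c ^ y' ≤ u + 250 →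
      checkEarlier a c x y' = true := by
  induction n with
  | zero => intro y h; cases h
  | succ n ih =>
    intro y h y' hy' hle
    have h' : Bool.rec true (Bool.rec false (scan a c x u n (y + 1) (c ^ (y + 1)))
        (checkEarlier a c x y)) (Nat.ble (c ^ y) (u + 250)) = true := h
    rw [Nat.ble_eq_true_of_le ((Nat.pow_le_pow_right hc hy').trans hle)] at h'
    cases hce : checkEarlier a c x y with
    | false => rw [hce] at h'; cases h'
    | true =>
      rw [hce] at h'
      rcases Nat.eq_or_lt_of_le hy' with rfl | hlt
      · exact hce
      · exact ih h' y' hlt hle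

/-- A merging walk through the powers `u = a ^ x` up to `2 ^ 52 = 4503599627370496` and `v = c ^ y`
that runs `checkEarlier` on all pairs at distance at most `250`. It fails if it takes `fuel` steps. -/
def walk (a c fuel : ℕ) : ℕ → ℕ → ℕ → ℕ → Bool :=
  Nat.rec (fun _ _ _ _ => false)
    (fun _ ih x y u v =>
      Bool.rec true
        (Bool.rec (ih x (Nat.succ y) u (Nat.mul v c))
          (Bool.rec false (ih (Nat.succ x) y (Nat.mul u a) v) (scan a c x u 300 y v))
          (Nat.ble u (Nat.add v 250)))
        (Nat.ble u 4503599627370496)) fuel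

lemma checkEarlier_of_walk {a c : ℕ} (ha : 1 ≤ a) (hc : 1 ≤ c) (n : ℕ) : ∀ {x y : ℕ},
    walk a c n x y (a ^ x) (c ^ y) = true → ∀ x' ≥ x, ∀ y' ≥ y, a ^ x' ≤ 2 ^ 52 →
      a ^ x' ≤ c ^ y' + 250 → c ^ y' ≤ a ^ x' + 250 → checkEarlier a c x' y' = true := by
  induction n with
  | zero => intro x y h; cases h
  | succ n ih =>
    intro x y h x' hx' y' hy' hle h₁ h₂
    have h' : Bool.rec true
        (Bool.rec (walk a c n x (y + 1) (a ^ x) (c ^ (y + 1)))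
          (Bool.rec false (walk a c n (x + 1) y (a ^ (x + 1)) (c ^ y))
            (scan a c x (a ^ x) 300 y (c ^ y)))
          (Nat.ble (a ^ x) (c ^ y + 250)))
        (Nat.ble (a ^ x) 4503599627370496) = true := h
    have hxx : a ^ x ≤ a ^ x' := Nat.pow_le_pow_right ha hx'
    rw [Nat.ble_eq_true_of_le (show a ^ x ≤ 4503599627370496 by omega)] at h'
    cases hb : Nat.ble (a ^ x) (c ^ y + 250) with
    | false =>
      rw [hb] at h'
      rcases Nat.eq_or_lt_of_le hy' with rfl | hlt
      · rw [Nat.ble_eq_true_of_le (by omega)] at hb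
        cases hb
      · exact ih h' x' hx' y' hlt hle h₁ h₂
    | true =>
      rw [hb] at h'
      cases hs : scan a c x (a ^ x) 300 y (c ^ y) with
      | false => rw [hs] at h'; cases h'
      | true =>
        rw [hs] at h'
        rcases Nat.eq_or_lt_of_le hx' with rfl | hlt
        · exact checkEarlier_of_scan hc 300 hs y' hy' h₂
        · exact ih h' x' hlt y' hy' hle h₁ h₂

/-! ### The check for all pairs of bases -/

/-- Either the Euclidean algorithm on the approximate logarithms `A`, `C` of `a`, `c` shows that
powers above `2 ^ 52` with exponents up to `10 ^ 8` are not close (`288230376151711744` is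
`2 ^ 58`), and the smaller powers pass the enumeration, or `a` and `c` have a common power. -/
def checkPair (a c A C : ℕ) : Bool :=
  Bool.rec (!allBelow 8 fun i => allBelow 8 fun j => !Nat.beq (a ^ (i + 1)) (c ^ (j + 1)))
    (walk a c 200 2 2 (a ^ 2) (c ^ 2))
    (Nat.ble 288230376151711744 (euclidRem 100000000 200 0 1 C A))

/-- The `n` pairs of the form `(k, A k)` with `k = m, m + 1, …`, where `A m = A` and the other `A k`
are obtained by adding approximate increments of the scaled logarithm. -/
def logTable (n : ℕ) : ℕ → ℕ → List (ℕ × ℕ) :=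
  Nat.rec (fun _ _ => []) (fun _ ih m A => (m, A) :: ih (m + 1) (A + logInc m)) n

/-- `checkPair` for one base `a` against all bases of a table. -/
def checkAgainst (a A : ℕ) (l : List (ℕ × ℕ)) : Bool :=
  List.rec true (fun p _ ih => Bool.rec false ih (checkPair a p.1 A p.2)) l

/-- `checkPair` for all pairs of bases of a table. -/
def checkTable (l : List (ℕ × ℕ)) : Bool :=
  List.rec true (fun p l ih => Bool.rec false ih (checkAgainst p.1 p.2 l)) l

lemma checkPair_of_checkAgainst {a A : ℕ} (n : ℕ) : ∀ {m C : ℕ}, 1 ≤ m → IsLogApprox m C →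
    checkAgainst a A (logTable n m C) = true → ∀ c, m ≤ c → c < m + n →
      ∃ C', IsLogApprox c C' ∧ checkPair a c A C' = true := by
  induction n with
  | zero => intro m C _ _ _ c h1 h2; omega
  | succ n ih =>
    intro m C hm hC h c h1 h2
    have h' : Bool.rec false (checkAgainst a A (logTable n (m + 1) (C + logInc m)))
      (checkPair a m A C) = true := h
    cases hp : checkPair a m A C with
    | false => rw [hp] at h'; cases h'
    | true =>
      rw [hp] at h'
      rcases Nat.eq_or_lt_of_le h1 with rfl | hlt
      · exact ⟨C, hC, hp⟩
      · exact ih (by omega) (hC.succ hm) h' c hlt (by omega)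

lemma checkPair_of_checkTable (n : ℕ) : ∀ {m A : ℕ}, 1 ≤ m → IsLogApprox m A →
    checkTable (logTable n m A) = true → ∀ a c, m ≤ a → a < c → c < m + n →
      ∃ A' C', IsLogApprox a A' ∧ IsLogApprox c C' ∧ checkPair a c A' C' = true := by
  induction n with
  | zero => intro m A _ _ _ a c h1 h2 h3; omega
  | succ n ih =>
    intro m A hm hA h a c h1 h2 h3
    have h' : Bool.rec false (checkTable (logTable n (m + 1) (A + logInc m)))
      (checkAgainst m A (logTable n (m + 1) (A + logInc m))) = true := h
    cases hp : checkAgainst m A (logTable n (m + 1) (A + logInc m)) with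
    | false => rw [hp] at h'; cases h'
    | true =>
      rw [hp] at h'
      rcases Nat.eq_or_lt_of_le h1 with rfl | hlt
      · obtain ⟨C', hC', hpair⟩ :=
          checkPair_of_checkAgainst n (by omega) (hA.succ hm) hp c (by omega) (by omega)
        exact ⟨A, C', hA, hC', hpair⟩
      · exact ih (by omega) (hA.succ hm) h' a c hlt h2 (by omega)

set_option maxRecDepth 100000 in
lemma checkTable_eq_true : checkTable (logTable 249 2 (0 + logInc 1)) = true := by
  decide +kernel

/-- For bases `a < c ≤ 250` without a common power, close powers are small. -/
lemma pow_le_of_close {a c A C x y : ℕ} (ha : 2 ≤ a) (hac : a < c) (hc : c ≤ 250)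
    (hA : IsLogApprox a A) (hC : IsLogApprox c C)
    (hr : 2 ^ 58 ≤ euclidRem 100000000 200 0 1 C A) (hne : a ^ x ≠ c ^ y)
    (h₁ : a ^ x ≤ c ^ y + 250) (h₂ : c ^ y ≤ a ^ x + 250) : a ^ x ≤ 2 ^ 52 := by
  by_contra! hbig
  have hyx : y ≤ x := le_of_pow_close hac (by omega) h₂
  have hx := exponent_lt ha hac hc hne h₁ h₂
  have hx0 : 0 < x := by
    rcases Nat.eq_zero_or_pos x with rfl | h
    · rw [pow_zero] at hbig; omega
    · exact h
  have hbig' : (2 : ℝ) ^ 52 < (a : ℝ) ^ x := by exact_mod_cast hbig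
  have hΛ : |x * Real.log a - y * Real.log c| ≤ 250 / (2 ^ 52 - 250) := by
    rw [← Real.log_pow, ← Real.log_pow]
    refine (abs_log_sub_log_le (by linarith) (by exact_mod_cast h₁)
      (by exact_mod_cast h₂)).trans ?_
    exact div_le_div_of_nonneg_left (by norm_num) (by norm_num) (by linarith)
  have hround : ∀ {m D z : ℕ}, IsLogApprox m D → m ≤ 250 → z < 10 ^ 8 →
      0 ≤ z * (2 ^ 100 * Real.log m - D) ∧
        z * (2 ^ 100 * Real.log m - D) ≤ (10 : ℝ) ^ 8 * 8500 := by
    intro m D z hD hm hz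
    have hm' : (m : ℝ) ≤ 250 := by exact_mod_cast hm
    have hz' : (z : ℝ) ≤ 10 ^ 8 := by exact_mod_cast hz.le
    exact ⟨mul_nonneg (by positivity) (by linarith [hD.1]),
      mul_le_mul hz' (by linarith [hD.2]) (by linarith [hD.1]) (by norm_num)⟩
  have hxA := hround hA (by omega) hx
  have hyC := hround hC hc (by omega : y < 10 ^ 8)
  have hlow : ((2 ^ 58 : ℕ) : ℤ) ≤ |(x : ℤ) * A - y * C| :=
    le_trans (by exact_mod_cast hr) (euclidRem_le_abs (B := 100000000) 200 (p₀ := 1) (p₁ := 0)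
      (s := 1) (t := 1) (by simp) (by simp) (by simp) (by simp) (by simp) x y
      (by exact_mod_cast hx0) (by exact_mod_cast hx.le))
  have hlow' : (2 : ℝ) ^ 58 ≤ |(x : ℝ) * A - y * C| := by exact_mod_cast hlow
  have hnum : (2 : ℝ) ^ 100 * (250 / (2 ^ 52 - 250)) + 10 ^ 8 * 8500 < 2 ^ 58 := by norm_num
  rw [abs_le] at hΛ
  rcases le_abs.1 hlow' with h | h <;> linarith [hΛ.1, hΛ.2, hxA.1, hxA.2, hyC.1, hyC.2]

theorem mem_solutionPairs {a c x₁ y₁ x₂ y₂ : ℕ} (ha : 2 ≤ a) (hac : a < c) (hc : c ≤ 250)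
    (hind : ∀ i j, 0 < i → 0 < j → a ^ i ≠ c ^ j) (hx₁ : 1 ≤ x₁) (hx : x₁ < x₂) (hy₁ : 1 ≤ y₁)
    (hy : y₁ < y₂) (h₁ : a ^ x₂ ≤ c ^ y₂ + 250) (h₂ : c ^ y₂ ≤ a ^ x₂ + 250)
    (heq : a ^ x₁ + c ^ y₂ = a ^ x₂ + c ^ y₁) : (a, c, x₁, y₁, x₂, y₂) ∈ solutionPairs := by
  obtain ⟨A, C, hA, hC, hpair⟩ := checkPair_of_checkTable 249 (by norm_num)
    (isLogApprox_one.succ le_rfl) checkTable_eq_true a c ha hac (by omega)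
  unfold checkPair at hpair
  cases hr : Nat.ble 288230376151711744 (euclidRem 100000000 200 0 1 C A) with
  | false =>
    rw [hr] at hpair
    replace hpair : (!allBelow 8 fun i => allBelow 8 fun j =>
      !Nat.beq (a ^ (i + 1)) (c ^ (j + 1))) = true := hpair
    rw [allBelow_of_forall fun i _ => allBelow_of_forall fun j _ => ?_] at hpair
    · cases hpair
    · rw [Bool.not_eq_true', Bool.eq_false_iff]
      exact fun h => hind _ _ i.succ_pos j.succ_pos (Nat.eq_of_beq_eq_true h)
  | true =>
    rw [hr] at hpair
    refine mem_of_checkEarlier (checkEarlier_of_walk (by omega) (by omega) 200 hpair x₂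
      (by omega) y₂ (by omega) ?_ h₁ h₂) hx₁ hx hy₁ hy heq
    exact pow_le_of_close ha hac hc hA hC (Nat.le_of_ble_eq_true hr)
      (hind _ _ (by omega) (by omega)) h₁ h₂

/-! ### Bases with a common power, and the final count -/

/-- Two powers of the same base determine their exponents from a nonzero difference. -/
lemma pow_add_pow_ne {g m₁ n₁ m₂ n₂ : ℕ} (hg : 2 ≤ g) (hm : m₁ < m₂) (hn : n₁ < n₂)
    (hne : g ^ m₁ ≠ g ^ n₁) : g ^ m₁ + g ^ n₂ ≠ g ^ m₂ + g ^ n₁ := by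
  -- If `k` is smaller than the other exponents, then `g ^ (k + 1)` divides all other powers.
  have key : ∀ k m n l : ℕ, k < m → k < n → k < l → g ^ k + g ^ n ≠ g ^ m + g ^ l := by
    intro k m n l hm hn hl h
    have h1 : g ^ (k + 1) ∣ g ^ k :=
      (Nat.dvd_add_left (pow_dvd_pow g hn)).1
        (h ▸ dvd_add (pow_dvd_pow g hm) (pow_dvd_pow g hl))
    have := (Nat.pow_dvd_pow_iff_le_right hg).1 h1
    omega
  intro h
  rcases lt_trichotomy m₁ n₁ with h1 | h1 | h1
  · exact key m₁ m₂ n₂ n₁ hm (h1.trans hn) h1 h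
  · exact hne (by rw [h1])
  · exact key n₁ n₂ m₂ m₁ hn (h1.trans hm) h1 (by omega)

/-- The equations with two solutions: `((a, b, c), (x₁, y₁), (x₂, y₂))` with `x₁ < x₂`. -/
def solutionTable : List ((ℕ × ℕ × ℕ) × (ℕ × ℕ) × (ℕ × ℕ)) :=
  [((2, 1, 3), (1, 1), (3, 2)), ((2, 4, 6), (1, 1), (5, 2)), ((2, 89, 91), (1, 1), (13, 2)),
   ((3, 5, 2), (1, 3), (3, 5)), ((3, 10, 13), (1, 1), (7, 3)), ((3, 13, 2), (1, 4), (5, 8)),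
   ((3, 13, 4), (1, 2), (5, 4)), ((3, 13, 16), (1, 1), (5, 2)), ((5, 3, 2), (1, 3), (3, 7)),
   ((6, 9, 15), (1, 1), (3, 2))]

lemma eq_of_mem_solutionTable :
    ∀ s ∈ solutionTable, ∀ t ∈ solutionTable, s.1 = t.1 → s = t := by
  decide

lemma mem_solutionTable {a b c : ℕ} (h : InRange a b c) {p q : ℕ × ℕ}
    (hp : p ∈ solutionSet a b c) (hq : q ∈ solutionSet a b c) (hpq : p.1 < q.1) :
    ((a, b, c), p, q) ∈ solutionTable := by
  obtain ⟨x₁, y₁⟩ := p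
  obtain ⟨x₂, y₂⟩ := q
  obtain ⟨⟨ha, ha'⟩, ⟨hb, hb'⟩, hc, hc'⟩ := h
  obtain ⟨hx₁, hy₁, h₁⟩ := hp
  obtain ⟨hx₂, hy₂, h₂⟩ := hq
  dsimp only at *
  have hy : y₁ < y₂ := by
    have h3 := Nat.pow_lt_pow_right ha hpq
    exact (Nat.pow_lt_pow_iff_right hc).1 (by omega)
  by_cases hind : ∀ i j, 0 < i → 0 < j → a ^ i ≠ c ^ j
  · have hac : a ≠ c := fun h => hind 1 1 one_pos one_pos (by rw [h])
    rcases lt_or_gt_of_ne hac with hlt | hlt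
    · have hmem := mem_solutionPairs ha hlt hc' hind hx₁ hpq hy₁ hy (by omega) (by omega)
        (by omega)
      simp only [solutionPairs, List.mem_cons, Prod.mk.injEq, List.not_mem_nil, or_false] at hmem
      rcases hmem with h | h | h | h | h | h | h | h | h | h <;>
        obtain ⟨rfl, rfl, rfl, rfl, rfl, rfl⟩ := h <;>
        first
          | omega
          | (obtain rfl := Nat.eq_sub_of_add_eq' h₁; decide)
    · have hmem := mem_solutionPairs hc hlt ha' (fun i j hi hj h => hind j i hj hi h.symm)
        hy₁ hy hx₁ hpq (by omega) (by omega) (by omega)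
      simp only [solutionPairs, List.mem_cons, Prod.mk.injEq, List.not_mem_nil, or_false] at hmem
      rcases hmem with h | h | h | h | h | h | h | h | h | h <;>
        obtain ⟨rfl, rfl, rfl, rfl, rfl, rfl⟩ := h <;>
        first
          | omega
          | (obtain rfl := Nat.eq_sub_of_add_eq' h₁; decide)
  · push Not at hind
    obtain ⟨i, j, hi, hj, hij⟩ := hind
    obtain ⟨g, hga, hgc⟩ := Nat.exists_eq_pow_of_pow_eq_pow (Or.inl hi.ne') hij
    have hd : 0 < Nat.gcd i j := Nat.gcd_pos_of_pos_left _ hi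
    have hj' : 0 < j / Nat.gcd i j := Nat.div_pos (Nat.gcd_le_right _ hj) hd
    have hi' : 0 < i / Nat.gcd i j := Nat.div_pos (Nat.gcd_le_left _ hi) hd
    have hg : 2 ≤ g := by
      by_contra! hg
      have : g ^ (j / Nat.gcd i j) ≤ 1 := pow_le_one₀ (by omega) (by omega)
      omega
    generalize j / Nat.gcd i j = e at *
    generalize i / Nat.gcd i j = f at *
    subst hga hgc
    simp only [← pow_mul] at h₁ h₂
    exact absurd (by omega) (pow_add_pow_ne hg (Nat.mul_lt_mul_of_pos_left hpq hj')
      (Nat.mul_lt_mul_of_pos_left hy hi') (by omega))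

lemma eq_of_fst_eq {a b c : ℕ} (hc : 2 ≤ c) {p q : ℕ × ℕ} (hp : p ∈ solutionSet a b c)
    (hq : q ∈ solutionSet a b c) (h : p.1 = q.1) : p = q := by
  refine Prod.ext h (Nat.pow_right_injective hc ?_)
  show c ^ p.2 = c ^ q.2
  rw [← hp.2.2, ← hq.2.2, h]

lemma solutionSet_eq_pair {a b c : ℕ} (h : InRange a b c) {p q : ℕ × ℕ}
    (hp : p ∈ solutionSet a b c) (hq : q ∈ solutionSet a b c) (hpq : p.1 < q.1) :
    solutionSet a b c = {p, q} := by
  refine Set.Subset.antisymm (fun r hr => ?_) (Set.insert_subset hp (by simpa using hq))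
  have hpq' := mem_solutionTable h hp hq hpq
  rcases lt_trichotomy p.1 r.1 with h1 | h1 | h1
  · have := eq_of_mem_solutionTable _ hpq' _ (mem_solutionTable h hp hr h1) rfl
    simp only [Prod.mk.injEq, true_and] at this
    exact Or.inr this.symm
  · exact Or.inl (eq_of_fst_eq h.2.2.1 hr hp h1.symm)
  · have := eq_of_mem_solutionTable _ hpq' _ (mem_solutionTable h hr hp h1) rfl
    simp only [Prod.mk.injEq, true_and] at this
    exact absurd h1 (by rw [this.1]; exact lt_irrefl _)

lemma encard_eq_two_of_one_lt_encard {a b c : ℕ} (h : InRange a b c)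
    (hcard : 1 < (solutionSet a b c).encard) :
    (solutionSet a b c).encard = 2 ∧ (a, b, c) ∈ twoSolutionTriples := by
  obtain ⟨p, q, hp, hq, hne⟩ := Set.one_lt_encard_iff.1 hcard
  wlog hlt : p.1 < q.1 generalizing p q
  · refine this q p hq hp hne.symm (lt_of_le_of_ne (not_lt.1 hlt) fun h' => hne ?_)
    exact eq_of_fst_eq h.2.2.1 hp hq h'.symm
  refine ⟨by rw [solutionSet_eq_pair h hp hq hlt, Set.encard_pair hne], ?_⟩
  have key : ∀ s ∈ solutionTable, s.1 ∈ twoSolutionTriples := by decide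
  exact key _ (mem_solutionTable h hp hq hlt)

lemma solutionSet_of_mem_solutionTable : ∀ s ∈ solutionTable,
    solutionSet s.1.1 s.1.2.1 s.1.2.2 = {s.2.1, s.2.2} := by
  intro s hs
  have key : ∀ s ∈ solutionTable, ((2 ≤ s.1.1 ∧ s.1.1 ≤ 250) ∧ (1 ≤ s.1.2.1 ∧ s.1.2.1 ≤ 250) ∧
      (2 ≤ s.1.2.2 ∧ s.1.2.2 ≤ 250)) ∧
      (1 ≤ s.2.1.1 ∧ 1 ≤ s.2.1.2 ∧ s.1.1 ^ s.2.1.1 + s.1.2.1 = s.1.2.2 ^ s.2.1.2) ∧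
      (1 ≤ s.2.2.1 ∧ 1 ≤ s.2.2.2 ∧ s.1.1 ^ s.2.2.1 + s.1.2.1 = s.1.2.2 ^ s.2.2.2) ∧
      s.2.1.1 < s.2.2.1 := by
    decide
  obtain ⟨h, hp, hq, hlt⟩ := key s hs
  exact solutionSet_eq_pair h hp hq hlt

theorem mainTheorem2 :
    IsGreatest {n : ℕ∞ | ∃ a b c : ℕ, InRange a b c ∧ (solutionSet a b c).encard = n} 2 ∧
    (∀ a b c : ℕ, InRange a b c →
      ((solutionSet a b c).encard = 2 ↔ (a, b, c) ∈ twoSolutionTriples)) ∧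
    solutionSet 2 1 3 = {(1, 1), (3, 2)} ∧
    solutionSet 2 4 6 = {(1, 1), (5, 2)} ∧
    solutionSet 2 89 91 = {(1, 1), (13, 2)} ∧
    solutionSet 3 5 2 = {(1, 3), (3, 5)} ∧
    solutionSet 3 10 13 = {(1, 1), (7, 3)} ∧
    solutionSet 3 13 2 = {(1, 4), (5, 8)} ∧
    solutionSet 3 13 4 = {(1, 2), (5, 4)} ∧
    solutionSet 3 13 16 = {(1, 1), (5, 2)} ∧
    solutionSet 5 3 2 = {(1, 3), (3, 7)} ∧
    solutionSet 6 9 15 = {(1, 1), (3, 2)} := by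
  have htable := solutionSet_of_mem_solutionTable
  have hcard : ∀ s ∈ solutionTable, (solutionSet s.1.1 s.1.2.1 s.1.2.2).encard = 2 := by
    intro s hs
    rw [htable s hs, Set.encard_pair]
    have key : ∀ s ∈ solutionTable, s.2.1 ≠ s.2.2 := by decide
    exact key s hs
  refine ⟨⟨⟨2, 1, 3, by unfold InRange; decide, hcard ((2, 1, 3), (1, 1), (3, 2)) (by decide)⟩, ?_⟩,
    fun a b c h => ⟨fun h2 => ?_, fun hmem => ?_⟩,
    htable ((2, 1, 3), (1, 1), (3, 2)) (by decide),
    htable ((2, 4, 6), (1, 1), (5, 2)) (by decide),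
    htable ((2, 89, 91), (1, 1), (13, 2)) (by decide),
    htable ((3, 5, 2), (1, 3), (3, 5)) (by decide),
    htable ((3, 10, 13), (1, 1), (7, 3)) (by decide),
    htable ((3, 13, 2), (1, 4), (5, 8)) (by decide),
    htable ((3, 13, 4), (1, 2), (5, 4)) (by decide),
    htable ((3, 13, 16), (1, 1), (5, 2)) (by decide),
    htable ((5, 3, 2), (1, 3), (3, 7)) (by decide),
    htable ((6, 9, 15), (1, 1), (3, 2)) (by decide)⟩
  · rintro n ⟨a, b, c, h, rfl⟩
    by_contra! hlt
    have := (encard_eq_two_of_one_lt_encard h (lt_trans (by norm_num) hlt)).1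
    exact hlt.ne' this
  · exact (encard_eq_two_of_one_lt_encard h (by rw [h2]; norm_num)).2
  · have key : ∀ t ∈ twoSolutionTriples, ∃ s ∈ solutionTable, s.1 = t := by decide
    obtain ⟨s, hs, hst⟩ := key _ hmem
    have := hcard s hs
    rwa [hst] at this
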